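/- **Definitions.** All graphs are finite and simple. For a set $\mathcal F$ of subgraphs of a graph $G$, let $V(\mathcal F)$ be the union of the vertex sets of its members and $G-\mathcal F=G-V(\mathcal F)$. The set $\mathcal F$ is a *subgraph cut* of $G$ if $G-\mathcal F$ is disconnected or consists of a single vertex. For a connected graph $H$, a subgraph cut is an *$H$-structure cut* (respectively an *$H$-substructure cut*) if each of its members is isomorphic to $H$ (respectively to a connected subgraph of $H$). The minimum cardinality of an $H$-structure cut (respectively $H$-substructure cut) of $G$ is denoted by $\kappa(G;H)$ (respectively $\kappa^s(G;H)$). Two-bit strings $x_1x_0$ and $y_1y_0$ are *pair related*, $x_1x_0\sim y_1y_0$, if $(x_1x_0,y_1y_0)\in\{(00,00),(10,10),(01,11),(11,01)\}$. The crossed cube $CQ_1$ is $K_2$ with vertices $0$ and $1$. For $n\ge2$, $CQ_n$ consists of two copies $CQ^0_{n-1}$, $CQ^1_{n-1}$ of $CQ_{n-1}$, with all labels prefixed by $0$ and by $1$ respectively, and of the edges joining $0u_{n-2}\ldots u_0$ and $1v_{n-2}\ldots v_0$ whenever $u_{n-2}=v_{n-2}$ if $n$ is even, and $u_{2i+1}u_{2i}\sim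 v_{2i+1}v_{2i}$ for all $0\le i<\lfloor\frac{n-1}{2}\rfloor$. The BCDC network $B_2$ is the $4$-cycle with vertices, in cyclic order, $[00,01],[01,11],[10,11],[00,10]$. For $n\ge3$, let $B^0_{n-1}$ and $B^1_{n-1}$ be the copies of $B_{n-1}$ in which each vertex $[x,y]$ is replaced by $[0x,0y]$ and by $[1x,1y]$ respectively. Then $B_n$ consists of $B^0_{n-1}$, $B^1_{n-1}$, the set of additional vertices $S_n=\{[a,b] : a\in V(CQ^0_{n-1}),\ b\in V(CQ^1_{n-1}),\ ab\in E(CQ_n)\}$, and the following additional edges: $[a,b]\in V(B^0_{n-1})$ is joined to $[c,d]\in S_n$ if and only if $a=c$ or $b=c$, and $[c,d]\in S_n$ is joined to $[e,f]\in V(B^1_{n-1})$ if and only if $e=d$ or $f=d$. There are no other edges. **Theorem 4.8.** Let $n\ge4$ and $2\le t\le 2n-3$ be integers, and let $r$ be the remainder of $n-1$ on division by $1+t$. Then $$\kappa(B_n;K_{1,t})=\kappa^s(B_n;K_{1,t})=\begin{cases}\dfrac{2n-4}{1+t}+1,&\text{if }2\le t\le n-3\text{ and }r=1,\\[2mm]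 2\left\lceil\dfrac{n-1}{1+t}\right\rceil,&\text{otherwise.}\end{cases}$$ -/

import Mathlib

/-- Binary strings `x_{n-1} … x_1 x_0` of length `n`; the bit `x_i` is the value at `i`. -/
abbrev BitString (n : ℕ) : Type := Fin n → Bool

/-- The string `b x_{n-1} … x_0`, obtained by prefixing the string `x` with the bit `b`. -/
def BitString.prepend {n : ℕ} (b : Bool) (x : BitString n) : BitString (n + 1) :=
  Fin.snoc (α := fun _ => Bool) x b

/-- The two-bit string `x₁x₀`. -/
def twoBits (x₁ x₀ : Bool) : BitString 2 := ![x₀, x₁]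

/-- `x₁x₀ ∼ y₁y₀`: the pair is one of `(00, 00)`, `(10, 10)`, `(01, 11)`, `(11, 01)`. -/
def PairRelated (x₁ x₀ y₁ y₀ : Bool) : Prop :=
  ((x₁, x₀), (y₁, y₀)) ∈
    ({((false, false), (false, false)), ((true, false), (true, false)),
      ((false, true), (true, true)), ((true, true), (false, true))} :
        Set ((Bool × Bool) × (Bool × Bool)))

/-- The condition under which `0u` and `1v` are joined in the crossed cube of dimension
`m + 1`, where `u = u_{m-1} … u_0` and `v = v_{m-1} … v_0`: if `m + 1` is even then
`u_{m-1} = v_{m-1}`, and `u_{2i+1}u_{2i} ∼ v_{2i+1}v_{2i}` for all `i < ⌊m / 2⌋`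
(equivalently `2i + 1 < m`). -/
def CrossRelated {m : ℕ} (u v : BitString m) : Prop :=
  (Even (m + 1) → ∀ i : Fin m, (i : ℕ) + 1 = m → u i = v i) ∧
    ∀ (i : ℕ) (h : 2 * i + 1 < m),
      PairRelated (u ⟨2 * i + 1, h⟩) (u ⟨2 * i, by omega⟩)
        (v ⟨2 * i + 1, h⟩) (v ⟨2 * i, by omega⟩)

/-- The crossed cube `CQ_n` (`n ≥ 1`; the value at `n = 0` is irrelevant). `CQ_1 = K_2`; the
next one consists of the copies of the previous one prefixed by `0` and by `1`, and of the
edges between `0u` and `1v` for cross related `u`, `v`. -/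
def crossedCube : (n : ℕ) → SimpleGraph (BitString n)
  | 0 => ⊥
  | 1 => ⊤
  | n + 2 => SimpleGraph.fromRel fun x y => ∃ u v : BitString (n + 1),
      (∃ b : Bool, x = u.prepend b ∧ y = v.prepend b ∧ (crossedCube (n + 1)).Adj u v) ∨
      (x = u.prepend false ∧ y = v.prepend true ∧ CrossRelated u v)

/-- Labels `[x, y]`. -/
abbrev PairLabel (n : ℕ) : Type := BitString n × BitString n

/-- Prefix both components of the label `[x, y]` with the bit `b`. -/
def PairLabel.prepend {n : ℕ} (b : Bool) (p : PairLabel n) : PairLabel (n + 1) :=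
  (BitString.prepend b p.1, BitString.prepend b p.2)

/-- The set `S_{n+1}` of labels `[0a, 1b]` such that `0a` and `1b` are joined in `CQ_{n+1}`. -/
def linkServers (n : ℕ) : Set (PairLabel (n + 1)) :=
  {p | ∃ a b : BitString n, p = (a.prepend false, b.prepend true) ∧
    (crossedCube (n + 1)).Adj (a.prepend false) (b.prepend true)}

/-- The vertices of the BCDC network `B_n`, `n ≥ 2`. -/
def bcdcServers : (n : ℕ) → Set (PairLabel n)
  | 0 => ∅
  | 1 => ∅
  | 2 => {(twoBits false false, twoBits false true), (twoBits false false, twoBits true false),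
      (twoBits false true, twoBits true true), (twoBits true false, twoBits true true)}
  | n + 3 => PairLabel.prepend false '' bcdcServers (n + 2) ∪
      PairLabel.prepend true '' bcdcServers (n + 2) ∪ linkServers (n + 2)

/-- The adjacency of the BCDC network on labels (labels that are no vertices of `B_n` are left
isolated here and are removed in `bcdc`). `B_2` is the 4-cycle
`[00,01], [01,11], [10,11], [00,10]`. For `n ≥ 3`, `B_n` has the edges of the two prefixed copies
of `B_{n-1}`; a vertex `[a, b]` of the `0`-copy is joined to `[c, d]` in `S_n` iff
`a = c` or `b = c`; a vertex `[e, f]` of the `1`-copy is joined to `[c, d]` in `S_n` iff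
`e = d` or `f = d`; there are no other edges. -/
def bcdcLabelGraph : (n : ℕ) → SimpleGraph (PairLabel n)
  | 0 => ⊥
  | 1 => ⊥
  | 2 => SimpleGraph.fromRel fun p q =>
      (p = (twoBits false false, twoBits false true) ∧
        q = (twoBits false true, twoBits true true)) ∨
      (p = (twoBits false true, twoBits true true) ∧
        q = (twoBits true false, twoBits true true)) ∨
      (p = (twoBits true false, twoBits true true) ∧
        q = (twoBits false false, twoBits true false)) ∨
      (p = (twoBits false false, twoBits true false) ∧
        q = (twoBits false false, twoBits false true))
  | n + 3 => SimpleGraph.fromRel fun p q =>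
      (∃ (b : Bool) (p' q' : PairLabel (n + 2)), p = p'.prepend b ∧ q = q'.prepend b ∧
        (bcdcLabelGraph (n + 2)).Adj p' q') ∨
      (p ∈ PairLabel.prepend false '' bcdcServers (n + 2) ∧ q ∈ linkServers (n + 2) ∧
        (p.1 = q.1 ∨ p.2 = q.1)) ∨
      (p ∈ linkServers (n + 2) ∧ q ∈ PairLabel.prepend true '' bcdcServers (n + 2) ∧
        (q.1 = p.2 ∨ q.2 = p.2))

/-- The `n`-dimensional BCDC network `B_n`, `n ≥ 2`. -/
def bcdc (n : ℕ) : SimpleGraph (bcdcServers n) :=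
  (bcdcLabelGraph n).induce (bcdcServers n)

/-- The union `V(𝓕)` of the vertex sets of the members of a set of subgraphs. -/
def subgraphVerts {V : Type*} {G : SimpleGraph V} (F : Set G.Subgraph) : Set V :=
  ⋃ S ∈ F, S.verts

/-- A set `F` of subgraphs of `G` is a subgraph cut if `G - V(F)` is disconnected or
trivial (has exactly one vertex). -/
def IsSubgraphCut {V : Type*} (G : SimpleGraph V) (F : Set G.Subgraph) : Prop :=
  ¬ (G.induce (subgraphVerts F)ᶜ).Preconnected ∨ ∃ v, (subgraphVerts F)ᶜ = {v}

/-- An `H`-structure cut: a subgraph cut all of whose members are isomorphic to `H`. -/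
def IsStructureCut {V W : Type*} (G : SimpleGraph V) (H : SimpleGraph W)
    (F : Set G.Subgraph) : Prop :=
  IsSubgraphCut G F ∧ ∀ S ∈ F, Nonempty (S.coe ≃g H)

/-- An `H`-substructure cut: a subgraph cut all of whose members are isomorphic to connected
subgraphs of `H`. -/
def IsSubstructureCut {V W : Type*} (G : SimpleGraph V) (H : SimpleGraph W)
    (F : Set G.Subgraph) : Prop :=
  IsSubgraphCut G F ∧ ∀ S ∈ F, ∃ H' : H.Subgraph, H'.Connected ∧ Nonempty (S.coe ≃g H'.coe)

/-- `κ(G; H)`: the smallest size of an `H`-structure cut of `G` (`⊤` if there is none). -/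
noncomputable def structureConnectivity {V W : Type*} (G : SimpleGraph V)
    (H : SimpleGraph W) : ℕ∞ :=
  ⨅ (F : Set G.Subgraph) (_ : IsStructureCut G H F), F.encard

/-- `κˢ(G; H)`: the smallest size of an `H`-substructure cut of `G` (`⊤` if there is none). -/
noncomputable def substructureConnectivity {V W : Type*} (G : SimpleGraph V)
    (H : SimpleGraph W) : ℕ∞ :=
  ⨅ (F : Set G.Subgraph) (_ : IsSubstructureCut G H F), F.encard

/-- The star `K_{1,t}`. -/
abbrev starK (t : ℕ) : SimpleGraph (Fin 1 ⊕ Fin t) :=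
  completeBipartiteGraph (Fin 1) (Fin t)

/-! The network is the line graph of the crossed cube `CQ_n`: each edge carries exactly one label,
and labels are adjacent when their edges share an endpoint (`IsLineModel`, `isLineModel_bcdc`). A
star with `s = 1 + t` vertices becomes `s` edges all meeting a common one among them. Beyond
`n`-regularity and size, only three facts about `CQ_n` matter: it has no triangles, it contains a
4-cycle, and a vertex set with at least 3 vertices inside and outside has at least `3n - 4` boundary
edges.

Lower bound: too few stars remove fewer than `3n - 4` edges, so if the rest is disconnected, some
surviving edge `uv` is isolated (`exists_isolated`). The `n - 1` other edges at `u` and those at `v`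
are then all covered. Without triangles, a star avoiding `uv` serves only one end, or at most one
edge at each end. The optimum of this covering problem is `twoSidedCover (n - 1) s`, by
`twoSidedCover_le`.

Upper bound: stars isolating an edge `uv` attain this number. If `n - 1` leaves remainder 1 modulo
`s`, one edge is left over at each end; choosing them in a 4-cycle through `uv`, a single star
centred at the opposite edge takes both. This saving is the exceptional case of the formula. -/

open Finset

/-! ### The structure of the crossed cube -/

/-- The matching between the two halves of the crossed cube. -/
def crossTwist {m : ℕ} (u : BitString m) : BitString m := fun i =>
  if (i : ℕ) % 2 = 1 then xor (u i) (u ⟨i - 1, by omega⟩) else u i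

theorem crossTwist_involutive {m : ℕ} : Function.Involutive (crossTwist (m := m)) := by
  intro u
  funext i
  unfold crossTwist
  by_cases h : (i : ℕ) % 2 = 1
  · have h' : ¬ ((i : ℕ) - 1) % 2 = 1 := by omega
    simp [h, h']
  · simp [h]

theorem pairRelated_iff (a b c d : Bool) : PairRelated a b c d ↔ c = xor a b ∧ d = b := by
  unfold PairRelated
  revert a b c d
  simp

/-- Pair relatedness is the graph of the map adding the low bit to the high bit, so the cross edges
form a perfect matching. The parity clause concerns exactly the top bit that has no partner when `m`
is odd. -/
theorem crossRelated_iff {m : ℕ} (u v : BitString m) : CrossRelated u v ↔ v = crossTwist u := by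
  unfold CrossRelated
  constructor
  · rintro ⟨h1, h2⟩
    funext i
    unfold crossTwist
    by_cases h : (i : ℕ) % 2 = 1
    · have := h2 (i / 2) (by omega)
      rw [pairRelated_iff] at this
      have e1 : (⟨2 * ((i : ℕ) / 2) + 1, by omega⟩ : Fin m) = i := Fin.ext (by simp; omega)
      have e2 : (⟨2 * ((i : ℕ) / 2), by omega⟩ : Fin m) = ⟨i - 1, by omega⟩ :=
        Fin.ext (by simp; omega)
      rw [if_pos h]
      have h3 := this.1
      rw [e1, e2] at h3
      exact h3
    · rw [if_neg h]
      by_cases hm : (i : ℕ) + 1 = m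
      · exact (h1 (by rw [Nat.even_iff]; omega) i hm).symm
      · have := h2 (i / 2) (by omega)
        rw [pairRelated_iff] at this
        have e2 : (⟨2 * ((i : ℕ) / 2), by omega⟩ : Fin m) = i := Fin.ext (by simp; omega)
        rw [e2] at this
        exact this.2
  · rintro rfl
    refine ⟨fun he i hi => ?_, fun i h => ?_⟩
    · rw [Nat.even_iff] at he
      simp [crossTwist, show ¬ (i : ℕ) % 2 = 1 by omega]
    · rw [pairRelated_iff]
      constructor
      · simp [crossTwist, show (2 * i + 1) % 2 = 1 by omega]
      · simp [crossTwist]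

theorem BitString.prepend_inj {n : ℕ} {b c : Bool} {u v : BitString n} :
    u.prepend b = v.prepend c ↔ b = c ∧ u = v := by
  constructor
  · intro h
    have := Fin.snoc_injective2 (α := fun _ : Fin (n + 1) => Bool) h
    exact ⟨this.2, this.1⟩
  · rintro ⟨rfl, rfl⟩; rfl

theorem BitString.exists_prepend {n : ℕ} (x : BitString (n + 1)) :
    ∃ b, ∃ u : BitString n, x = u.prepend b :=
  ⟨x (Fin.last n), Fin.init x, (Fin.snoc_init_self x).symm⟩

/-- Strings of length `n + 1` are pairs of a leading bit and a string of length `n`. -/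
noncomputable def BitString.prependEquiv (n : ℕ) : Bool × BitString n ≃ BitString (n + 1) :=
  Equiv.ofBijective (fun p => p.2.prepend p.1)
    ⟨fun _ _ h => Prod.ext (prepend_inj.1 h).1 (prepend_inj.1 h).2,
      fun x => let ⟨b, u, h⟩ := x.exists_prepend; ⟨(b, u), h.symm⟩⟩

theorem BitString.sum_prepend {n : ℕ} (f : BitString (n + 1) → ℕ) :
    ∑ x, f x = ∑ u : BitString n, f (u.prepend false) + ∑ u : BitString n, f (u.prepend true) := by
  rw [← (BitString.prependEquiv n).sum_comp, Fintype.sum_prod_type, Fintype.sum_bool, add_comm]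
  rfl

/-- The recursion "two copies plus a perfect matching" holds already from dimension 0, since
`crossedCube 0` is edgeless. The inductions on the crossed cube rest on it. -/
theorem crossedCube_adj_prepend {n : ℕ} {b c : Bool} {u v : BitString n} :
    (crossedCube (n + 1)).Adj (u.prepend b) (v.prepend c) ↔
      (b = c ∧ (crossedCube n).Adj u v) ∨ (b ≠ c ∧ v = crossTwist u) := by
  cases n with
  | zero =>
    have : u = v := Subsingleton.elim _ _
    have h2 : v = crossTwist u := Subsingleton.elim _ _
    subst this
    simp only [crossedCube, SimpleGraph.top_adj, ne_eq, BitString.prepend_inj,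
      SimpleGraph.bot_adj, and_false, false_or, and_true]
    tauto
  | succ n =>
    simp only [crossedCube, SimpleGraph.fromRel_adj, ne_eq, BitString.prepend_inj,
      crossRelated_iff]
    have key : v = crossTwist u ↔ u = crossTwist v :=
      ⟨fun h => by rw [h, crossTwist_involutive], fun h => by rw [h, crossTwist_involutive]⟩
    constructor
    · rintro ⟨-, ⟨u', v', h | h⟩ | ⟨u', v', h | h⟩⟩
      · obtain ⟨d, ⟨rfl, rfl⟩, ⟨rfl, rfl⟩, h⟩ := h
        exact Or.inl ⟨rfl, h⟩
      · obtain ⟨⟨rfl, rfl⟩, ⟨rfl, rfl⟩, h⟩ := h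
        exact Or.inr ⟨by simp, h⟩
      · obtain ⟨d, ⟨rfl, rfl⟩, ⟨rfl, rfl⟩, h⟩ := h
        exact Or.inl ⟨rfl, h.symm⟩
      · obtain ⟨⟨rfl, rfl⟩, ⟨rfl, rfl⟩, h⟩ := h
        exact Or.inr ⟨by simp, key.2 h⟩
    · rintro (⟨rfl, h⟩ | ⟨h, h'⟩)
      · exact ⟨fun h' => h.ne h'.2, Or.inl ⟨u, v, Or.inl ⟨b, ⟨rfl, rfl⟩, ⟨rfl, rfl⟩, h⟩⟩⟩
      · refine ⟨fun h'' => h h''.1, ?_⟩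
        cases b <;> cases c
        · exact absurd rfl h
        · exact Or.inl ⟨u, v, Or.inr ⟨⟨rfl, rfl⟩, ⟨rfl, rfl⟩, h'⟩⟩
        · exact Or.inr ⟨v, u, Or.inr ⟨⟨rfl, rfl⟩, ⟨rfl, rfl⟩, key.1 h'⟩⟩
        · exact absurd rfl h

/-- A triangle not inside one copy would have two matching edges at one vertex. -/
theorem crossedCube_not_triangle (n : ℕ) (x y z : BitString n) (hxy : (crossedCube n).Adj x y)
    (hyz : (crossedCube n).Adj y z) (hxz : (crossedCube n).Adj x z) : False := by
  induction n with
  | zero => exact hxy.ne (Subsingleton.elim _ _)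
  | succ n ih =>
    obtain ⟨a, x, rfl⟩ := x.exists_prepend
    obtain ⟨b, y, rfl⟩ := y.exists_prepend
    obtain ⟨c, z, rfl⟩ := z.exists_prepend
    rw [crossedCube_adj_prepend] at hxy hyz hxz
    have inv := crossTwist_involutive (m := n)
    rcases hxy with ⟨e1, h1⟩ | ⟨e1, h1⟩ <;> rcases hyz with ⟨e2, h2⟩ | ⟨e2, h2⟩ <;>
      rcases hxz with ⟨e3, h3⟩ | ⟨e3, h3⟩
    · exact ih _ _ _ h1 h2 h3
    · exact e3 (e1.trans e2)
    · exact e2 (e1.symm.trans e3)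
    · exact h1.ne (inv.injective (h3.symm.trans h2))
    · exact e1 (e3.trans e2.symm)
    · exact h2.ne (h1.trans h3.symm)
    · rw [h2, h1, inv] at h3; exact h3.ne rfl
    · revert e1 e2 e3; cases a <;> cases b <;> cases c <;> simp

theorem crossedCube_exists_square (n : ℕ) : ∃ u v u' v' : BitString (n + 2),
    (crossedCube (n + 2)).Adj u v ∧ (crossedCube (n + 2)).Adj u u' ∧
    (crossedCube (n + 2)).Adj v v' ∧ (crossedCube (n + 2)).Adj u' v' ∧ u' ≠ v ∧ v' ≠ u := by
  induction n with
  | zero =>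
    let o : BitString 0 := Fin.elim0
    have ho (w : BitString 1) : crossTwist w = w := by
      funext i
      have : i = 0 := Subsingleton.elim _ _
      subst this
      simp [crossTwist]
    refine ⟨(o.prepend false).prepend false, (o.prepend true).prepend false,
      (o.prepend false).prepend true, (o.prepend true).prepend true, ?_, ?_, ?_, ?_, ?_, ?_⟩
    all_goals simp only [crossedCube_adj_prepend, BitString.prepend_inj, ho, ne_eq]
    all_goals simp [show crossTwist o = o from Subsingleton.elim _ _]
  | succ n ih =>
    obtain ⟨u, v, u', v', h1, h2, h3, h4, h5, h6⟩ := ih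
    refine ⟨u.prepend false, v.prepend false, u'.prepend false, v'.prepend false, ?_⟩
    simp only [crossedCube_adj_prepend, BitString.prepend_inj, ne_eq, true_and]
    exact ⟨Or.inl h1, Or.inl h2, Or.inl h3, Or.inl h4, h5, h6⟩

/-! ### Edge isoperimetry -/

/-- The number of ordered pairs `(x, y) ∈ X × Y` of adjacent vertices. -/
noncomputable def adjPairs {V : Type*} [Fintype V] (G : SimpleGraph V) (X Y : Finset V) : ℕ := by
  classical exact ∑ x, ∑ y, if x ∈ X ∧ y ∈ Y ∧ G.Adj x y then 1 else 0

open Classical in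
theorem crossedCube_degree (n : ℕ) (x : BitString n) :
    ∑ y, (if (crossedCube n).Adj x y then 1 else 0) = n := by
  induction n with
  | zero =>
    simp [crossedCube]
  | succ n ih =>
    obtain ⟨b, u, rfl⟩ := x.exists_prepend
    rw [BitString.sum_prepend]
    simp only [crossedCube_adj_prepend]
    cases b
    · simp only [true_and, ne_eq, not_true, false_and, or_false, ih]
      simp
    · simp only [true_and, ne_eq, not_true, false_and, or_false, ih]
      simp [add_comm]

theorem adjPairs_add_compl {V : Type*} [Fintype V] [DecidableEq V] (G : SimpleGraph V) (n : ℕ)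
    (hG : ∀ x, (open Classical in ∑ y, (if G.Adj x y then 1 else 0)) = n) (X : Finset V) :
    adjPairs G X X + adjPairs G X Xᶜ = n * #X := by
  classical
  unfold adjPairs
  rw [← sum_add_distrib, mul_comm, ← smul_eq_mul, ← sum_const,
    ← sum_filter_add_sum_filter_not univ (· ∈ X)]
  rw [filter_mem_eq_inter, univ_inter]
  rw [sum_eq_zero (s := univ.filter (· ∉ X)) fun x hx => by simp [(mem_filter.1 hx).2], add_zero]
  refine sum_congr rfl fun x hx => ?_
  rw [← sum_add_distrib]
  conv_rhs => rw [← hG x]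
  refine sum_congr rfl fun y _ => ?_
  by_cases hy : y ∈ X <;> simp [hx, hy]

/-- For the convex `f(x) = x log x` this says `f(2a) + f(b) ≤ f(a) + f(a + b)`: the points `2a` and
`b` lie between `a` and `a + b` and have the same sum. -/
theorem mul_log_add_ge {a b : ℝ} (ha : 0 ≤ a) (hab : a ≤ b) :
    a * Real.log a + b * Real.log b + 2 * a * Real.log 2 ≤ (a + b) * Real.log (a + b) := by
  rcases ha.eq_or_lt with rfl | ha
  · simp
  have hb : 0 < b := ha.trans_le hab
  have hl : 0 ≤ 1 - a / b := sub_nonneg.2 ((div_le_one hb).2 hab)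
  have hc := Real.convexOn_mul_log.2 (x := a) (y := a + b) ha.le (Set.mem_Ici.2 (by positivity))
  have h1 := hc hl (by positivity : 0 ≤ a / b) (by ring)
  have h2 := hc (by positivity : 0 ≤ a / b) hl (by ring)
  simp only [smul_eq_mul] at h1 h2
  have e1 : (1 - a / b) * a + a / b * (a + b) = 2 * a := by field_simp; ring
  have e2 : a / b * a + (1 - a / b) * (a + b) = b := by field_simp; ring
  rw [e1, Real.log_mul two_ne_zero ha.ne'] at h1
  rw [e2] at h2
  linarith

/-- Split `X` between the two copies. The matching adds at most the smaller part's size in edges,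
hence twice that in ordered pairs, which is the gain allowed by `mul_log_add_ge`. -/
theorem adjPairs_le (n : ℕ) (X : Finset (BitString n)) :
    adjPairs (crossedCube n) X X * Real.log 2 ≤ #X * Real.log #X := by
  classical
  induction n with
  | zero =>
    have : adjPairs (crossedCube 0) X X = 0 := by simp [adjPairs, crossedCube]
    rw [this, Nat.cast_zero, zero_mul]
    rcases X.eq_empty_or_nonempty with rfl | h
    · simp
    · exact Real.mul_log_nonneg (by exact_mod_cast h.card_pos)
  | succ n ih =>
    let Y (b : Bool) : Finset (BitString n) := univ.filter fun u => u.prepend b ∈ X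
    have hcard : #X = #(Y false) + #(Y true) := by
      have := BitString.sum_prepend (fun x => if x ∈ X then 1 else 0)
      simpa [Y] using this
    have hcross (b : Bool) : (∑ u : BitString n, ∑ v : BitString n,
        if u.prepend b ∈ X ∧ v.prepend (!b) ∈ X ∧ v = crossTwist u then 1 else 0) ≤
        min #(Y false) #(Y true) := by
      have e1 : (∑ u : BitString n, ∑ v : BitString n,
          if u.prepend b ∈ X ∧ v.prepend (!b) ∈ X ∧ v = crossTwist u then 1 else 0) =
          #(univ.filter fun u : BitString n =>
            u.prepend b ∈ X ∧ (crossTwist u).prepend (!b) ∈ X) := by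
        rw [card_filter]
        refine sum_congr rfl fun u _ => ?_
        rw [sum_eq_single (crossTwist u)]
        · simp
        · intro v _ hv; simp [hv]
        · simp
      have h1 : #(univ.filter fun u : BitString n =>
            u.prepend b ∈ X ∧ (crossTwist u).prepend (!b) ∈ X) ≤ #(Y b) :=
        card_le_card fun u hu => by simp [Y] at hu ⊢; exact hu.1
      have h2 : #(univ.filter fun u : BitString n =>
            u.prepend b ∈ X ∧ (crossTwist u).prepend (!b) ∈ X) ≤ #(Y !b) :=
        card_le_card_of_injOn crossTwist (fun u hu => by simp [Y] at hu ⊢; exact hu.2)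
          crossTwist_involutive.injective.injOn
      rw [e1]
      cases b
      · exact le_min h1 h2
      · exact le_min h2 h1
    have hsplit : adjPairs (crossedCube (n + 1)) X X ≤
        adjPairs (crossedCube n) (Y false) (Y false) + adjPairs (crossedCube n) (Y true) (Y true) +
          2 * min #(Y false) #(Y true) := by
      have h1 := hcross false
      have h2 := hcross true
      simp only [Bool.not_false, Bool.not_true] at h1 h2
      unfold adjPairs
      simp only [BitString.sum_prepend, crossedCube_adj_prepend, sum_add_distrib, Y, mem_filter,
        mem_univ, true_and, ne_eq, not_true, false_and, or_false, false_or, reduceCtorEq,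
        not_false_eq_true] at h1 h2 ⊢
      omega
    have i1 := ih (Y false)
    have i2 := ih (Y true)
    have hs : (adjPairs (crossedCube (n + 1)) X X : ℝ) ≤
        adjPairs (crossedCube n) (Y false) (Y false) + adjPairs (crossedCube n) (Y true) (Y true) +
          2 * (min #(Y false) #(Y true) : ℕ) := by exact_mod_cast hsplit
    have hlog : 0 ≤ Real.log 2 := Real.log_nonneg (by norm_num)
    have hs' := mul_le_mul_of_nonneg_right hs hlog
    rw [hcard]
    push_cast at hs' ⊢
    rcases le_total #(Y false) #(Y true) with h | h
    · have h' : (#(Y false) : ℝ) ≤ #(Y true) := by exact_mod_cast h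
      have := mul_log_add_ge (Nat.cast_nonneg _) h'
      rw [min_eq_left h'] at hs'
      linarith
    · have h' : (#(Y true) : ℝ) ≤ #(Y false) := by exact_mod_cast h
      have := mul_log_add_ge (Nat.cast_nonneg _) h'
      rw [min_eq_right h'] at hs'
      rw [add_comm (#(Y true) : ℝ)] at this
      linarith

theorem adjPairs_comm {V : Type*} [Fintype V] (G : SimpleGraph V) (X Y : Finset V) :
    adjPairs G X Y = adjPairs G Y X := by
  classical
  unfold adjPairs
  rw [sum_comm]
  refine sum_congr rfl fun y _ => sum_congr rfl fun x _ => ?_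
  simp only [G.adj_comm x y]
  congr 1
  exact propext (by tauto)

/-- By regularity and `adjPairs_le`, a set of size `x` has boundary at least `nx - x log₂ x`. This
is concave in `x`, so on `[4, 2^(n-1)]` the endpoint values `4(n - 2)` and `2^(n-1)` decide. -/
theorem le_adjPairs_compl_of_le {n : ℕ} (hn : 4 ≤ n) (X : Finset (BitString n)) (h3 : 3 ≤ #X)
    (hX : 2 * #X ≤ 2 ^ n) : 3 * n - 4 ≤ adjPairs (crossedCube n) X Xᶜ := by
  classical
  have hadd := adjPairs_add_compl (crossedCube n) n (crossedCube_degree n) X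
  have hle := adjPairs_le n X
  have hlog : 0 < Real.log 2 := Real.log_pos (by norm_num)
  obtain ⟨m, rfl⟩ : ∃ m, n = m + 4 := ⟨n - 4, by omega⟩
  rcases h3.eq_or_lt with h3 | h3
  · rw [← h3] at hadd hle
    -- At size 3 the real bound `3n - 3 log₂ 3` falls short of `3n - 4`; integrality and `3 ^ 3 < 2
    -- ^ 5` close the gap.
    have h5 : adjPairs (crossedCube (m + 4)) X X < 5 := by
      have : (adjPairs (crossedCube (m + 4)) X X : ℝ) * Real.log 2 < 5 * Real.log 2 := by
        refine hle.trans_lt ?_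
        have := Real.log_lt_log (by norm_num) (by norm_num : (3 : ℝ) ^ 3 < 2 ^ 5)
        rw [Real.log_pow, Real.log_pow] at this
        exact_mod_cast this
      exact_mod_cast lt_of_mul_lt_mul_right this hlog.le
    omega
  · have hconc : ConcaveOn ℝ (Set.Ici (0 : ℝ))
        (fun x => (m + 4) * Real.log 2 * x - x * Real.log x) := by
      refine ConcaveOn.sub ?_ Real.convexOn_mul_log
      exact (LinearMap.mulLeft ℝ ((m + 4) * Real.log 2)).concaveOn (convex_Ici 0)
    have hX' : (#X : ℝ) ∈ Set.Icc (4 : ℝ) (2 ^ (m + 3)) := by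
      refine ⟨by exact_mod_cast h3, ?_⟩
      have : #X ≤ 2 ^ (m + 3) := by rw [pow_succ] at hX; omega
      exact_mod_cast this
    have key := hconc.min_le_of_mem_Icc (Set.mem_Ici.2 (by norm_num)) (Set.mem_Ici.2 (by positivity))
      hX'
    have h4 : Real.log 4 = 2 * Real.log 2 := by
      rw [show (4 : ℝ) = 2 ^ 2 by norm_num, Real.log_pow]; norm_num
    have hb : ((3 * m + 8 : ℕ) : ℝ) * Real.log 2 ≤
        min ((m + 4) * Real.log 2 * 4 - 4 * Real.log 4)
          ((m + 4) * Real.log 2 * 2 ^ (m + 3) - 2 ^ (m + 3) * Real.log (2 ^ (m + 3))) := by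
      refine le_min ?_ ?_
      · rw [h4]; push_cast; nlinarith [mul_nonneg (Nat.cast_nonneg (α := ℝ) m) hlog.le]
      · rw [Real.log_pow]
        have : 3 * m + 8 ≤ 2 ^ (m + 3) := by
          clear * -
          induction m with
          | zero => norm_num
          | succ m ih => rw [pow_succ]; have := Nat.lt_two_pow_self (n := m); omega
        have : ((3 * m + 8 : ℕ) : ℝ) ≤ 2 ^ (m + 3) := by exact_mod_cast this
        have := mul_le_mul_of_nonneg_right this hlog.le
        push_cast at this ⊢
        nlinarith
    have hadd' : (adjPairs (crossedCube (m + 4)) X X : ℝ) + adjPairs (crossedCube (m + 4)) X Xᶜ =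
        (m + 4) * #X := by exact_mod_cast hadd
    have hfin : ((3 * m + 8 : ℕ) : ℝ) * Real.log 2 ≤
        adjPairs (crossedCube (m + 4)) X Xᶜ * Real.log 2 := by
      have := hb.trans key
      have e : (adjPairs (crossedCube (m + 4)) X Xᶜ : ℝ) =
        (m + 4) * #X - adjPairs (crossedCube (m + 4)) X X := by linarith
      rw [e, sub_mul]
      linarith
    have : 3 * m + 8 ≤ adjPairs (crossedCube (m + 4)) X Xᶜ := by
      exact_mod_cast le_of_mul_le_mul_right hfin hlog
    omega

theorem le_adjPairs_compl {n : ℕ} (hn : 4 ≤ n) (X : Finset (BitString n)) (h3 : 3 ≤ #X)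
    (h3' : 3 ≤ #Xᶜ) : 3 * n - 4 ≤ adjPairs (crossedCube n) X Xᶜ := by
  have hc : #X + #Xᶜ = 2 ^ n := by
    rw [card_add_card_compl]; simp
  rcases le_total #X #Xᶜ with h | h
  · exact le_adjPairs_compl_of_le hn X h3 (by omega)
  · have := le_adjPairs_compl_of_le hn Xᶜ h3' (by omega)
    rwa [compl_compl, adjPairs_comm] at this

/-! ### The BCDC network is the line graph of the crossed cube -/

theorem PairLabel.prepend_inj {n : ℕ} {b c : Bool} {p q : PairLabel n} :
    p.prepend b = q.prepend c ↔ b = c ∧ p = q := by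
  simp only [PairLabel.prepend, Prod.ext_iff, BitString.prepend_inj]
  tauto

theorem mem_linkServers {n : ℕ} {p : PairLabel (n + 1)} :
    p ∈ linkServers n ↔ ∃ u : BitString n, p = (u.prepend false, (crossTwist u).prepend true) := by
  unfold linkServers
  simp only [crossedCube_adj_prepend, Set.mem_ofPred_eq]
  constructor
  · rintro ⟨a, b, rfl, h⟩
    simp only [reduceCtorEq, false_and, ne_eq, not_false_eq_true, true_and, false_or] at h
    exact ⟨a, by rw [h]⟩
  · rintro ⟨u, rfl⟩
    exact ⟨u, _, rfl, Or.inr ⟨by simp, rfl⟩⟩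

theorem twoBits_inj {a b c d : Bool} : twoBits a b = twoBits c d ↔ a = c ∧ b = d := by
  revert a b c d
  decide

theorem crossedCube_two_adj (x y : BitString 2) : (crossedCube 2).Adj x y ↔
    (x 0 = y 0 ∧ x 1 ≠ y 1) ∨ (x 0 ≠ y 0 ∧ x 1 = y 1) := by
  obtain ⟨a, x, rfl⟩ := x.exists_prepend
  obtain ⟨b, y, rfl⟩ := y.exists_prepend
  have e0 (a : Bool) (x : BitString 1) : x.prepend a 0 = x 0 := rfl
  have e1 (a : Bool) (x : BitString 1) : x.prepend a 1 = a := rfl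
  have ht : crossTwist x = x := by
    funext i
    have : i = 0 := Subsingleton.elim _ _
    subst this
    simp [crossTwist]
  have hx : x = y ↔ x 0 = y 0 := by
    rw [funext_iff]; simp [Fin.forall_fin_one]
  rw [crossedCube_adj_prepend, ht, e0, e0, e1, e1, ← hx]
  simp only [crossedCube, SimpleGraph.top_adj, eq_comm (a := y)]
  tauto

theorem crossedCube_adj_of_mem_bcdcServers (n : ℕ) (p : PairLabel n) (hp : p ∈ bcdcServers n) :
    (crossedCube n).Adj p.1 p.2 := by
  induction n with
  | zero => exact hp.elim
  | succ n ih =>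
    match n, ih with
    | 0, _ => exact hp.elim
    | 1, _ =>
      rw [crossedCube_two_adj]
      rcases hp with rfl | rfl | rfl | rfl <;> simp [twoBits]
    | n + 2, ih =>
      rcases hp with (⟨q, hq, rfl⟩ | ⟨q, hq, rfl⟩) | hp
      · exact crossedCube_adj_prepend.2 (Or.inl ⟨rfl, ih q hq⟩)
      · exact crossedCube_adj_prepend.2 (Or.inl ⟨rfl, ih q hq⟩)
      · obtain ⟨u, rfl⟩ := mem_linkServers.1 hp
        exact crossedCube_adj_prepend.2 (Or.inr ⟨by simp, rfl⟩)

theorem mem_bcdcServers_or_swap (n : ℕ) (hn : 2 ≤ n) (x y : BitString n)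
    (h : (crossedCube n).Adj x y) : (x, y) ∈ bcdcServers n ∨ (y, x) ∈ bcdcServers n := by
  induction n, hn using Nat.le_induction with
  | base =>
    rw [crossedCube_two_adj] at h
    have key (x : BitString 2) : x = twoBits (x 1) (x 0) := by
      funext i; fin_cases i <;> rfl
    rw [key x, key y]
    generalize x 0 = a, x 1 = b, y 0 = c, y 1 = d at h
    simp only [bcdcServers, Set.mem_insert_iff, Set.mem_singleton_iff]
    revert a b c d
    decide
  | succ n hn ih =>
    obtain ⟨n, rfl⟩ : ∃ m, n = m + 2 := ⟨n - 2, by omega⟩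
    obtain ⟨a, x, rfl⟩ := x.exists_prepend
    obtain ⟨b, y, rfl⟩ := y.exists_prepend
    rcases crossedCube_adj_prepend.1 h with ⟨rfl, hxy⟩ | ⟨hab, rfl⟩
    · have (p : PairLabel (n + 2)) (hp : p ∈ bcdcServers (n + 2)) :
          p.prepend a ∈ bcdcServers (n + 3) := by
        cases a
        · exact Or.inl (Or.inl ⟨p, hp, rfl⟩)
        · exact Or.inl (Or.inr ⟨p, hp, rfl⟩)
      exact (ih x y hxy).imp (this _) (this _)
    · cases a <;> cases b
      · exact absurd rfl hab
      · exact Or.inl (Or.inr (mem_linkServers.2 ⟨x, rfl⟩))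
      · refine Or.inr (Or.inr (mem_linkServers.2 ⟨crossTwist x, ?_⟩))
        rw [crossTwist_involutive]
      · exact absurd rfl hab

/-- Together with `mem_bcdcServers_or_swap`, each edge is labelled in exactly one orientation:
prefixing preserves it, and link labels always point from the 0-copy to the 1-copy. -/
theorem swap_notMem_bcdcServers (n : ℕ) (x y : BitString n) (h : (x, y) ∈ bcdcServers n) :
    (y, x) ∉ bcdcServers n := by
  induction n with
  | zero => exact h.elim
  | succ n ih =>
    match n, ih with
    | 0, _ => exact h.elim
    | 1, _ =>
      have key (x : BitString 2) : x = twoBits (x 1) (x 0) := by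
        funext i; fin_cases i <;> rfl
      revert h
      rw [key x, key y]
      generalize x 0 = a, x 1 = b, y 0 = c, y 1 = d
      simp only [bcdcServers, Set.mem_insert_iff, Set.mem_singleton_iff]
      revert a b c d
      decide
    | n + 2, ih =>
      intro h'
      obtain ⟨a, x, rfl⟩ := x.exists_prepend
      obtain ⟨b, y, rfl⟩ := y.exists_prepend
      simp only [bcdcServers, Set.mem_union, Set.mem_image, mem_linkServers, PairLabel.prepend,
        Prod.mk.injEq, BitString.prepend_inj, Prod.exists] at h h'
      rcases h with (⟨x, y, h, ⟨rfl, rfl⟩, ⟨rfl, rfl⟩⟩ | ⟨x, y, h, ⟨rfl, rfl⟩, ⟨rfl, rfl⟩⟩) |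
        ⟨u, ⟨rfl, rfl⟩, ⟨rfl, rfl⟩⟩
      · simp only [true_and, reduceCtorEq, false_and, and_false, exists_false, or_false] at h'
        obtain ⟨y, x, h', rfl, rfl⟩ := h'
        exact ih _ _ h h'
      · simp only [true_and, reduceCtorEq, false_and, and_false, exists_false, or_false,
          false_or] at h'
        obtain ⟨y, x, h', rfl, rfl⟩ := h'
        exact ih _ _ h h'
      · simp at h'

/-- The recursive rules omit no shared endpoint: the two copies have disjoint endpoints, and
distinct link labels are disjoint because the cross edges form a matching. -/
theorem bcdcLabelGraph_adj_iff (n : ℕ) (hn : 2 ≤ n) (p q : PairLabel n) (hp : p ∈ bcdcServers n)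
    (hq : q ∈ bcdcServers n) : (bcdcLabelGraph n).Adj p q ↔
      p ≠ q ∧ (p.1 = q.1 ∨ p.1 = q.2 ∨ p.2 = q.1 ∨ p.2 = q.2) := by
  induction n, hn using Nat.le_induction with
  | base =>
    simp only [bcdcLabelGraph, SimpleGraph.fromRel_adj]
    rcases hp with rfl | rfl | rfl | rfl <;> rcases hq with rfl | rfl | rfl | rfl <;>
      simp [twoBits_inj]
  | succ n hn ih =>
    obtain ⟨n, rfl⟩ : ∃ m, n = m + 2 := ⟨n - 2, by omega⟩
    have hl (p : PairLabel (n + 2)) (hp : p ∈ bcdcServers (n + 2)) : p.1 ≠ p.2 :=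
      (crossedCube_adj_of_mem_bcdcServers _ p hp).ne
    simp only [bcdcLabelGraph, SimpleGraph.fromRel_adj]
    refine and_congr_right fun hpq => ?_
    have inv := crossTwist_involutive (m := n + 2)
    simp only [bcdcServers, Set.mem_union, Set.mem_image, mem_linkServers] at hp hq
    rcases hp with (⟨⟨x, y⟩, hp, rfl⟩ | ⟨⟨x, y⟩, hp, rfl⟩) | ⟨u, rfl⟩ <;>
    rcases hq with (⟨⟨x', y'⟩, hq, rfl⟩ | ⟨⟨x', y'⟩, hq, rfl⟩) | ⟨v, rfl⟩
    all_goals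
      simp only [Set.mem_image, mem_linkServers, PairLabel.prepend, Prod.mk.injEq,
        BitString.prepend_inj, Prod.exists, reduceCtorEq, false_and, and_false, exists_false,
        true_and, or_false, false_or, not_and, ne_eq] at hpq ⊢
    all_goals
      simp only [and_assoc, exists_and_left, exists_eq_left', true_and,
        reduceCtorEq, false_and, and_false, or_false, false_or, exists_eq_right_right,
        exists_eq_right]
    all_goals try simp only [hp, true_and]
    all_goals try simp only [hq, true_and]
    · rw [SimpleGraph.adj_comm _ (x', y'), or_self, ih _ _ hp hq]
      simp only [ne_eq, Prod.mk.injEq, not_and]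
      exact ⟨And.right, fun h => ⟨hpq, h⟩⟩
    · rw [SimpleGraph.adj_comm _ (x', y'), or_self, ih _ _ hp hq]
      simp only [ne_eq, Prod.mk.injEq, not_and]
      exact ⟨And.right, fun h => ⟨hpq, h⟩⟩
    · rw [eq_comm, eq_comm (a := y')]
    · rw [eq_comm, eq_comm (a := y')]
    · rw [inv.injective.eq_iff, or_self, false_iff]
      exact fun h => hpq h (congrArg _ h)

/-- The edge of the crossed cube that a vertex of the BCDC network stands for. -/
def serverEdge {n : ℕ} (p : bcdcServers n) : Sym2 (BitString n) := s(p.1.1, p.1.2)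

theorem serverEdge_injective {n : ℕ} : Function.Injective (serverEdge (n := n)) := by
  rintro ⟨⟨x, y⟩, hp⟩ ⟨⟨z, w⟩, hq⟩ h
  simp only [serverEdge, Sym2.eq_iff] at h
  rcases h with ⟨rfl, rfl⟩ | ⟨rfl, rfl⟩
  · rfl
  · exact absurd hq (swap_notMem_bcdcServers n x y hp)

theorem range_serverEdge {n : ℕ} (hn : 2 ≤ n) :
    Set.range (serverEdge (n := n)) = (crossedCube n).edgeSet := by
  ext e
  induction e with | _ x y
  constructor
  · rintro ⟨p, hp⟩
    rw [← hp]
    exact crossedCube_adj_of_mem_bcdcServers n p.1 p.2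
  · intro h
    rcases mem_bcdcServers_or_swap n hn x y h with h | h
    · exact ⟨⟨_, h⟩, rfl⟩
    · exact ⟨⟨_, h⟩, Sym2.eq_swap⟩

theorem bcdc_adj_iff {n : ℕ} (hn : 2 ≤ n) (p q : bcdcServers n) :
    (bcdc n).Adj p q ↔ p ≠ q ∧ ∃ v, v ∈ serverEdge p ∧ v ∈ serverEdge q := by
  rw [bcdc, SimpleGraph.induce_adj, bcdcLabelGraph_adj_iff n hn _ _ p.2 q.2, Subtype.coe_ne_coe]
  refine and_congr_right fun _ => ?_
  simp only [serverEdge, Sym2.mem_iff]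
  constructor
  · rintro (h | h | h | h)
    · exact ⟨_, Or.inl rfl, Or.inl h⟩
    · exact ⟨_, Or.inl rfl, Or.inr h⟩
    · exact ⟨_, Or.inr rfl, Or.inl h⟩
    · exact ⟨_, Or.inr rfl, Or.inr h⟩
  · rintro ⟨v, rfl | rfl, h | h⟩ <;> simp [h]

/-! ### Lower bound -/

/-- `e` identifies `B` with the line graph of `G`. -/
structure IsLineModel {V W : Type*} (B : SimpleGraph W) (G : SimpleGraph V) (e : W → Sym2 V) :
    Prop where
  injective : Function.Injective e
  range_eq : Set.range e = G.edgeSet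
  adj_iff : ∀ p q, B.Adj p q ↔ p ≠ q ∧ ∃ v, v ∈ e p ∧ v ∈ e q

/-- A set of at most `s` pairs, all of which meet a common member of the set that is an edge of `G`. -/
def IsEdgeStar {V : Type*} (G : SimpleGraph V) (s : ℕ) (A : Finset (Sym2 V)) : Prop :=
  #A ≤ s ∧ ∃ c ∈ A, c ∈ G.edgeSet ∧ ∀ d ∈ A, ∃ v, v ∈ c ∧ v ∈ d

/-- Either the hub is present and joined to every leaf present, or, leaves being pairwise
nonadjacent, there is just one vertex. -/
theorem starK_subgraph_exists_center {t : ℕ} (H : (starK t).Subgraph) (hH : H.Connected) :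
    ∃ c ∈ H.verts, ∀ w ∈ H.verts, w = c ∨ H.Adj c w := by
  have key : ∀ w ∈ H.verts, H.verts.Nontrivial → ∃ x, H.Adj w x := fun w hw hnt => by
    have : Nontrivial H.verts := Set.nontrivial_coe_sort.2 hnt
    exact hH.preconnected.exists_adj_of_nontrivial ⟨w, hw⟩
  by_cases h0 : Sum.inl 0 ∈ H.verts
  · refine ⟨_, h0, fun w hw => ?_⟩
    rcases w with i | j
    · exact Or.inl (congrArg _ (Subsingleton.elim _ _))
    · right
      obtain ⟨x, hx⟩ := key _ hw ⟨_, hw, _, h0, by simp⟩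
      rcases x with i | j'
      · rw [Subsingleton.elim 0 i]; exact hx.symm
      · have := hx.adj_sub; simp at this
  · obtain ⟨c, hc⟩ := hH.nonempty
    refine ⟨c, hc, fun w hw => ?_⟩
    by_contra! hne
    obtain ⟨x, hx⟩ := key _ hw ⟨_, hw, _, hc, hne.1⟩
    have hx' := hx.adj_sub
    rcases w with i | j
    · rw [Subsingleton.elim i 0] at hw; exact h0 hw
    · rcases x with i | j'
      · rw [Subsingleton.elim i 0] at hx; exact h0 hx.snd_mem
      · simp at hx'

theorem exists_center_of_iso {W : Type*} {B : SimpleGraph W} {t : ℕ} (S : B.Subgraph)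
    (H : (starK t).Subgraph) (hH : H.Connected) (φ : S.coe ≃g H.coe) :
    S.verts.ncard ≤ 1 + t ∧ ∃ c ∈ S.verts, ∀ w ∈ S.verts, w = c ∨ B.Adj c w := by
  constructor
  · rw [← Nat.card_coe_set_eq, Nat.card_congr φ.toEquiv, Nat.card_coe_set_eq]
    calc _ ≤ (Set.univ : Set (Fin 1 ⊕ Fin t)).ncard := Set.ncard_le_ncard (Set.subset_univ _)
      _ = 1 + t := by rw [Set.ncard_univ]; simp
  · obtain ⟨c, hc, h⟩ := starK_subgraph_exists_center H hH
    refine ⟨φ.symm ⟨c, hc⟩, Subtype.coe_prop _, fun w hw => ?_⟩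
    rcases h (φ ⟨w, hw⟩) (Subtype.coe_prop _) with h | h
    · left
      have : φ ⟨w, hw⟩ = ⟨c, hc⟩ := Subtype.ext h
      rw [← this]; simp
    · right
      have : H.coe.Adj ⟨c, hc⟩ (φ ⟨w, hw⟩) := h
      rw [← φ.symm.map_adj_iff] at this
      simpa using S.adj_sub this

namespace IsLineModel

variable {V W : Type*} {B : SimpleGraph W} {G : SimpleGraph V} {e : W → Sym2 V}

theorem eq_of_subset_of_card_le_two (h : IsLineModel B G e) {Y : Finset V} (hY : #Y ≤ 2) {p q : W}
    (hp : ∀ v ∈ e p, v ∈ Y) (hq : ∀ v ∈ e q, v ∈ Y) : p = q := by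
  classical
  have key : ∀ r, (∀ v ∈ e r, v ∈ Y) → (e r).toFinset = Y := fun r hr => by
    have hr' : e r ∈ G.edgeSet := h.range_eq ▸ Set.mem_range_self r
    have : #(e r).toFinset = 2 := Sym2.card_toFinset_of_not_isDiag _ (G.not_isDiag_of_mem_edgeSet hr')
    exact eq_of_subset_of_card_le (fun v hv => hr v (Sym2.mem_toFinset.1 hv)) (by omega)
  apply h.injective
  ext v
  rw [← Sym2.mem_toFinset, ← Sym2.mem_toFinset, key p hp, key q hq]

theorem adjPairs_compl_le [Fintype V] [DecidableEq V] (h : IsLineModel B G e) (X : Finset V)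
    (D : Finset W) (hD : ∀ r x y, x ∈ X → y ∉ X → e r = s(x, y) → r ∈ D) :
    adjPairs G X Xᶜ ≤ #D := by
  classical
  have : adjPairs G X Xᶜ = #((univ : Finset (V × V)).filter fun z =>
      z.1 ∈ X ∧ z.2 ∈ Xᶜ ∧ G.Adj z.1 z.2) := by
    rw [card_filter, Fintype.sum_prod_type]
    unfold adjPairs
    convert rfl
  rw [this, ← card_image_of_injective D h.injective]
  refine card_le_card_of_injOn (fun z => s(z.1, z.2)) ?_ ?_
  · rintro ⟨x, y⟩ hz
    simp only [coe_filter, mem_univ, true_and, mem_compl] at hz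
    obtain ⟨hx, hy, ha⟩ := hz
    obtain ⟨r, hr⟩ : s(x, y) ∈ Set.range e := h.range_eq ▸ ha
    exact mem_coe.2 (mem_image.2 ⟨r, hD r x y hx hy hr, hr⟩)
  · rintro ⟨x, y⟩ hz ⟨x', y'⟩ hz' heq
    simp only [coe_filter, mem_univ, true_and, mem_compl] at hz hz'
    simp only [Sym2.eq_iff] at heq
    rcases heq with ⟨rfl, rfl⟩ | ⟨rfl, rfl⟩
    · rfl
    · exact absurd hz.1 hz'.2.1

/-- Let `A` be a component of the rest and `X` the set of endpoints of its edges. A surviving edge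
meeting `X` belongs to `A`, so the whole boundary of `X` lies in `D`. Hence `X` or its complement
has at most two vertices and holds at most one edge, which is isolated. -/
theorem exists_isolated [Fintype V] [Fintype W] [DecidableEq V] (h : IsLineModel B G e) {N : ℕ}
    (hiso : ∀ X : Finset V, 3 ≤ #X → 3 ≤ #Xᶜ → N ≤ adjPairs G X Xᶜ) (D : Set W)
    (hD : ¬ (B.induce Dᶜ).Preconnected) (hN : D.ncard < N) :
    ∃ p ∉ D, ∀ q, B.Adj p q → q ∈ D := by
  classical
  simp only [SimpleGraph.Preconnected, not_forall] at hD
  obtain ⟨⟨a, ha⟩, ⟨b, hb⟩, hab⟩ := hD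
  let A : Set W := {q | ∃ hq : q ∈ Dᶜ, (B.induce Dᶜ).Reachable ⟨a, ha⟩ ⟨q, hq⟩}
  have haA : a ∈ A := ⟨ha, .refl _⟩
  have hstep : ∀ q ∈ A, ∀ r ∉ D, ∀ v, v ∈ e q → v ∈ e r → r ∈ A := by
    rintro q ⟨hq, hr⟩ r hrD v hvq hvr
    refine ⟨hrD, ?_⟩
    by_cases hqr : q = r
    · subst hqr; exact hr
    · refine hr.trans (SimpleGraph.Adj.reachable ?_)
      exact (h.adj_iff q r).2 ⟨hqr, v, hvq, hvr⟩
  have hbA : b ∉ A := fun ⟨_, hr⟩ => hab hr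
  let X : Finset V := univ.filter fun v => ∃ q ∈ A, v ∈ e q
  have hX : ∀ v, v ∈ X ↔ ∃ q ∈ A, v ∈ e q := fun v => by simp [X]
  have hle : adjPairs G X Xᶜ ≤ #D.toFinset := by
    refine h.adjPairs_compl_le X _ fun r x y hx hy hr => ?_
    rw [Set.mem_toFinset]
    by_contra hrD
    obtain ⟨q, hq, hxq⟩ := (hX x).1 hx
    have := hstep q hq r hrD x hxq (by simp [hr])
    exact hy ((hX y).2 ⟨r, this, by simp [hr]⟩)
  rw [← Set.ncard_eq_toFinset_card'] at hle
  by_cases h3 : 3 ≤ #X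
  · have h3' : ¬ 3 ≤ #Xᶜ := fun h3' => by have := hiso X h3 h3'; omega
    have hout : ∀ q ∉ D, q ∉ A → ∀ v ∈ e q, v ∈ Xᶜ := fun q hqD hqA v hv => by
      rw [mem_compl, hX]
      rintro ⟨r, hr, hvr⟩
      exact hqA (hstep r hr q hqD v hvr hv)
    refine ⟨b, hb, fun q hq => ?_⟩
    by_contra hqD
    obtain ⟨hne, v, hvb, hvq⟩ := (h.adj_iff b q).1 hq
    refine hne (h.eq_of_subset_of_card_le_two (Y := Xᶜ) (by omega) (hout b hb hbA)
      (hout q hqD fun hqA => hbA (hstep q hqA b hb v hvq hvb)))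
  · refine ⟨a, ha, fun q hq => ?_⟩
    by_contra hqD
    obtain ⟨hne, v, hva, hvq⟩ := (h.adj_iff a q).1 hq
    have hqA := hstep a haA q hqD v hva hvq
    exact hne (h.eq_of_subset_of_card_le_two (Y := X) (by omega)
      (fun w hw => (hX w).2 ⟨a, haA, hw⟩) (fun w hw => (hX w).2 ⟨q, hqA, hw⟩))

end IsLineModel

/-! ### Covering the edges at both ends of an isolated edge. -/

/-- The edges at `u` other than `s(u, v)`. -/
noncomputable def otherEdges {V : Type*} [Fintype V] (G : SimpleGraph V) (u v : V) :
    Finset (Sym2 V) := by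
  classical exact (G.incidenceFinset u).erase s(u, v)

theorem mem_otherEdges {V : Type*} [Fintype V] {G : SimpleGraph V} {u v : V} {d : Sym2 V} :
    d ∈ otherEdges G u v ↔ ∃ w, G.Adj u w ∧ w ≠ v ∧ d = s(u, w) := by
  classical
  unfold otherEdges
  simp only [mem_erase, SimpleGraph.mem_incidenceFinset, SimpleGraph.incidenceSet]
  constructor
  · rintro ⟨h1, h2, h3⟩
    obtain ⟨w, rfl⟩ := Sym2.mem_iff_exists.1 h3
    exact ⟨w, h2, fun hw => h1 (hw ▸ rfl), rfl⟩
  · rintro ⟨w, h1, h2, rfl⟩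
    refine ⟨?_, h1, by simp⟩
    rw [ne_eq, Sym2.eq_iff]
    rintro (⟨-, h⟩ | ⟨h, h'⟩)
    · exact h2 h
    · exact h2 (h'.trans h)

theorem card_otherEdges {V : Type*} [Fintype V] {G : SimpleGraph V} [DecidableRel G.Adj] {u v : V}
    (h : G.Adj u v) : #(otherEdges G u v) = G.degree u - 1 := by
  classical
  unfold otherEdges
  rw [card_erase_of_mem, SimpleGraph.card_incidenceFinset_eq_degree]
  · congr!
  · rw [SimpleGraph.mem_incidenceFinset]; exact ⟨h, by simp⟩

/-- In a triangle-free graph, a star of edges avoiding the edge `uv` cannot cover more than one edge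
at `u` together with an edge at `v`. -/
theorem edgeStar_cover_trichotomy {V : Type*} [Fintype V] [DecidableEq V] {G : SimpleGraph V}
    (htri : ∀ x y z, G.Adj x y → G.Adj y z → G.Adj x z → False) {u v : V} (huv : G.Adj u v)
    {s : ℕ} {A : Finset (Sym2 V)} (hA : IsEdgeStar G s A) (hnot : s(u, v) ∉ A) :
    A ∩ otherEdges G v u = ∅ ∨ A ∩ otherEdges G u v = ∅ ∨
      (#(A ∩ otherEdges G u v) ≤ 1 ∧ #(A ∩ otherEdges G v u) ≤ 1) := by
  obtain ⟨-, c, hcA, hcG, hc⟩ := hA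
  -- If the centre is `ux` with `x ≠ v`, an edge `vw` with `w ≠ u` can meet it only at `w = x`,
  -- closing the triangle `u v x`.
  have side : ∀ u v, G.Adj u v → s(u, v) ∉ A → u ∈ c → A ∩ otherEdges G v u = ∅ := by
    intro u v huv hnot hu
    rw [eq_empty_iff_forall_notMem]
    intro d hd
    obtain ⟨hdA, hd⟩ := mem_inter.1 hd
    obtain ⟨w, hvw, hwu, rfl⟩ := mem_otherEdges.1 hd
    obtain ⟨x, rfl⟩ := Sym2.mem_iff_exists.1 hu
    rw [SimpleGraph.mem_edgeSet] at hcG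
    obtain ⟨y, hy, hy'⟩ := hc _ hdA
    rw [Sym2.mem_iff] at hy hy'
    rcases hy with rfl | rfl <;> rcases hy' with rfl | rfl
    · exact huv.ne rfl
    · exact hwu rfl
    · exact hnot hcA
    · exact htri _ _ _ huv hvw hcG
  -- Two edges `uw`, `uw'` meeting a centre that misses `u` force the centre to be `ww'`, again a
  -- triangle.
  have one : ∀ u v, u ∉ c → #(A ∩ otherEdges G u v) ≤ 1 := by
    intro u v hu
    rw [card_le_one]
    intro d hd d' hd'
    obtain ⟨hdA, hd⟩ := mem_inter.1 hd
    obtain ⟨w, huw, -, rfl⟩ := mem_otherEdges.1 hd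
    obtain ⟨hdA', hd'⟩ := mem_inter.1 hd'
    obtain ⟨w', huw', -, rfl⟩ := mem_otherEdges.1 hd'
    have hw : w ∈ c := by
      obtain ⟨y, hy, hy'⟩ := hc _ hdA
      rcases Sym2.mem_iff.1 hy' with rfl | rfl
      · exact absurd hy hu
      · exact hy
    have hw' : w' ∈ c := by
      obtain ⟨y, hy, hy'⟩ := hc _ hdA'
      rcases Sym2.mem_iff.1 hy' with rfl | rfl
      · exact absurd hy hu
      · exact hy
    by_contra hne
    have hww : w ≠ w' := fun h => hne (h ▸ rfl)
    have : c = s(w, w') := (Sym2.mem_and_mem_iff hww).1 ⟨hw, hw'⟩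
    rw [this, SimpleGraph.mem_edgeSet] at hcG
    exact htri _ _ _ huw hcG huw'
  by_cases hu : u ∈ c
  · exact Or.inl (side u v huv hnot hu)
  by_cases hv : v ∈ c
  · exact Or.inr (Or.inl (side v u huv.symm (by rwa [Sym2.eq_swap]) hv))
  · exact Or.inr (Or.inr ⟨one u v hu, one v u hv⟩)

/-- Here `a` counts the stars with nothing at `v`, `b` those of the others with nothing at `u`, and
`c` the mixed ones, which contribute at most one edge to each end. -/
theorem edgeStar_cover_counts {V ι : Type*} [Fintype V] [DecidableEq V] {G : SimpleGraph V}
    (htri : ∀ x y z, G.Adj x y → G.Adj y z → G.Adj x z → False) {u v : V} (huv : G.Adj u v)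
    {s : ℕ} (I : Finset ι) (T : ι → Finset (Sym2 V)) (hT : ∀ i ∈ I, IsEdgeStar G s (T i))
    (hnot : ∀ i ∈ I, s(u, v) ∉ T i) (hu : ∀ d ∈ otherEdges G u v, ∃ i ∈ I, d ∈ T i)
    (hv : ∀ d ∈ otherEdges G v u, ∃ i ∈ I, d ∈ T i) :
    ∃ a b c, a + b + c = #I ∧ #(otherEdges G u v) ≤ a * s + c ∧
      #(otherEdges G v u) ≤ b * s + c := by
  classical
  have tri := fun i hi => edgeStar_cover_trichotomy htri huv (hT i hi) (hnot i hi)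
  let P i := T i ∩ otherEdges G v u = ∅
  let Q i := T i ∩ otherEdges G u v = ∅
  let a := #(I.filter P)
  let b := #((I.filter (¬ P ·)).filter Q)
  let c := #((I.filter (¬ P ·)).filter (¬ Q ·))
  have hcard : a + (b + c) = #I := by
    rw [card_filter_add_card_filter_not (s := I.filter (¬ P ·)),
      card_filter_add_card_filter_not]
  have hcov : ∀ O : Finset (Sym2 V), (∀ d ∈ O, ∃ i ∈ I, d ∈ T i) → #O ≤ ∑ i ∈ I, #(T i ∩ O) := by
    intro O hO
    refine le_trans (card_le_card fun d hd => ?_) card_biUnion_le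
    obtain ⟨i, hi, hdi⟩ := hO d hd
    exact mem_biUnion.2 ⟨i, hi, mem_inter.2 ⟨hdi, hd⟩⟩
  have hs : ∀ i ∈ I, ∀ O, #(T i ∩ O) ≤ s := fun i hi O =>
    (card_le_card inter_subset_left).trans (hT i hi).1
  refine ⟨a, b, c, by omega, ?_, ?_⟩
  · refine (hcov _ hu).trans ?_
    rw [← sum_filter_add_sum_filter_not I P, ← sum_filter_add_sum_filter_not (I.filter (¬ P ·)) Q,
      ← add_assoc]
    have h1 : ∑ i ∈ I with P i, #(T i ∩ otherEdges G u v) ≤ a * s :=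
      sum_le_card_nsmul _ _ _ fun i hi => hs i (mem_filter.1 hi).1 _
    have h2 : ∑ i ∈ I.filter (¬ P ·) with Q i, #(T i ∩ otherEdges G u v) = 0 :=
      sum_eq_zero fun i hi => card_eq_zero.2 (mem_filter.1 hi).2
    have h3 : ∑ i ∈ I.filter (¬ P ·) with ¬ Q i, #(T i ∩ otherEdges G u v) ≤ c * 1 :=
      sum_le_card_nsmul _ _ _ fun i hi => by
        simp only [mem_filter] at hi
        rcases tri i hi.1.1 with h | h | h
        · exact absurd h hi.1.2
        · exact absurd h hi.2
        · exact h.1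
    omega
  · refine (hcov _ hv).trans ?_
    rw [← sum_filter_add_sum_filter_not I P, ← sum_filter_add_sum_filter_not (I.filter (¬ P ·)) Q]
    have h1 : ∑ i ∈ I with P i, #(T i ∩ otherEdges G v u) = 0 :=
      sum_eq_zero fun i hi => card_eq_zero.2 (mem_filter.1 hi).2
    have h2 : ∑ i ∈ I.filter (¬ P ·) with Q i, #(T i ∩ otherEdges G v u) ≤ b * s :=
      sum_le_card_nsmul _ _ _ fun i hi => hs i (mem_filter.1 (mem_filter.1 hi).1).1 _
    have h3 : ∑ i ∈ I.filter (¬ P ·) with ¬ Q i, #(T i ∩ otherEdges G v u) ≤ c * 1 :=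
      sum_le_card_nsmul _ _ _ fun i hi => by
        simp only [mem_filter] at hi
        rcases tri i hi.1.1 with h | h | h
        · exact absurd h hi.1.2
        · exact absurd h hi.2
        · exact h.2
    omega

/-- The least number of sets of size `s` that cover two disjoint sets of size `m`, when each of them
lies on one side or has at most one element on each side. -/
def twoSidedCover (m s : ℕ) : ℕ :=
  if m % s = 0 then 2 * (m / s) else if m % s = 1 then 2 * (m / s) + 1 else 2 * (m / s) + 2

/-- Since `2 ≤ s`, two mixed sets can be traded for one set on each side, so at most one mixed set
(`f`) remains. It helps only when the remainder is 1. -/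
theorem twoSidedCover_le {m s a b c : ℕ} (hs : 2 ≤ s) (ha : m ≤ a * s + c) (hb : m ≤ b * s + c) :
    twoSidedCover m s ≤ a + b + c := by
  have hd := Nat.div_add_mod m s
  have hr := Nat.mod_lt m (by omega : 0 < s)
  obtain ⟨d, f, hf, rfl⟩ : ∃ d f, f < 2 ∧ c = 2 * d + f :=
    ⟨c / 2, c % 2, by omega, by omega⟩
  have key : ∀ a, m ≤ a * s + (2 * d + f) → s * (m / s) + m % s ≤ s * (a + d) + f := fun a ha => by
    rw [hd]; nlinarith
  have main : ∀ x, s * (m / s) + m % s ≤ s * x + f →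
      m / s ≤ x ∧ (f < m % s → m / s + 1 ≤ x) := by
    intro x hx
    constructor
    · by_contra! hlt
      have := Nat.mul_le_mul_left s (Nat.succ_le_of_lt hlt)
      rw [Nat.mul_succ] at this
      omega
    · intro hf
      by_contra! hlt
      have := Nat.mul_le_mul_left s (Nat.le_of_lt_succ hlt)
      omega
  have hA := main _ (key a ha)
  have hB := main _ (key b hb)
  unfold twoSidedCover
  split_ifs <;> omega

/-- Keeps the removed edges below the isoperimetric threshold. The critical case is `k ≤ 2q + 1`:
there `2qs ≤ 2(n - 1)`, and the extra `s` is at most `qs`, or at most `2n - 2` if `q = 0`. -/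
theorem mul_lt_of_lt_twoSidedCover {n s k : ℕ} (hn : 4 ≤ n) (hs' : s ≤ 2 * n - 2)
    (hs : 3 ≤ s) (hk : k < twoSidedCover (n - 1) s) : k * s < 3 * n - 4 := by
  have hd := Nat.div_add_mod (n - 1) s
  have hr := Nat.mod_lt (n - 1) (by omega : 0 < s)
  unfold twoSidedCover at hk
  generalize (n - 1) / s = q at *
  generalize (n - 1) % s = r at *
  have h2 : k * s + s ≤ (if r = 0 then 2 * q else if r = 1 then 2 * q + 1 else 2 * q + 2) * s := by
    rw [← Nat.succ_mul]; exact Nat.mul_le_mul_right s hk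
  have e0 : 2 * q * s = 2 * (s * q) := by ring
  split_ifs at h2 with h0 h1
  · omega
  · rw [Nat.succ_mul] at h2; omega
  · rw [Nat.add_mul] at h2
    rcases Nat.eq_zero_or_pos q with rfl | hq
    · omega
    · have := Nat.mul_le_mul_left s hq
      omega

/-- Ensures that the optimal stars spare an edge besides `uv`. The worst case is `2qs + 2s`, with
`2qs ≤ 2n - 2` and `2s ≤ 4n - 4`. -/
theorem twoSidedCover_mul_le {n s : ℕ} (hn : 4 ≤ n) (hs' : s ≤ 2 * n - 2) (hs : 3 ≤ s) :
    twoSidedCover (n - 1) s * s + 1 < 6 * n := by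
  have hd := Nat.div_add_mod (n - 1) s
  have hr := Nat.mod_lt (n - 1) (by omega : 0 < s)
  unfold twoSidedCover
  generalize (n - 1) / s = q at *
  generalize (n - 1) % s = r at *
  have e0 : 2 * q * s = 2 * (s * q) := by ring
  split_ifs
  · omega
  · rw [Nat.succ_mul]; omega
  · rw [Nat.add_mul]; omega

theorem IsLineModel.twoSidedCover_le_encard {V W : Type*} [Fintype V] [DecidableEq V] [Fintype W]
    {B : SimpleGraph W} {G : SimpleGraph V} [DecidableRel G.Adj] {e : W → Sym2 V}
    (h : IsLineModel B G e) {n t : ℕ} (hn : 4 ≤ n) (ht : 2 ≤ t) (ht' : t ≤ 2 * n - 3)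
    (hdeg : ∀ v, G.degree v = n) (hcard : 6 * n ≤ Fintype.card W)
    (htri : ∀ x y z, G.Adj x y → G.Adj y z → G.Adj x z → False)
    (hiso : ∀ X : Finset V, 3 ≤ #X → 3 ≤ #Xᶜ → 3 * n - 4 ≤ adjPairs G X Xᶜ)
    (F : Set B.Subgraph) (hF : IsSubstructureCut B (starK t) F) :
    (twoSidedCover (n - 1) (1 + t) : ℕ∞) ≤ F.encard := by
  classical
  by_contra! hlt
  obtain ⟨hcut, hiso'⟩ := hF
  have hfin : F.Finite := Set.encard_lt_top_iff.1 (hlt.trans (ENat.natCast_lt_top _))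
  obtain ⟨I, rfl⟩ := hfin.exists_finset_coe
  rw [Set.encard_coe_eq_coe_finsetCard, Nat.cast_lt] at hlt
  have hstar : ∀ S ∈ I, S.verts.ncard ≤ 1 + t ∧ ∃ c ∈ S.verts, ∀ w ∈ S.verts, w = c ∨ B.Adj c w :=
    fun S hS => by
      obtain ⟨H, hH, ⟨φ⟩⟩ := hiso' S hS
      exact exists_center_of_iso S H hH φ
  set D := subgraphVerts (I : Set B.Subgraph) with hD
  have hDmem : ∀ w, w ∈ D ↔ ∃ S ∈ I, w ∈ S.verts := fun w => by simp [D, subgraphVerts]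
  have hDcard : D.ncard < 3 * n - 4 := by
    refine lt_of_le_of_lt ?_ (mul_lt_of_lt_twoSidedCover hn (by omega) (by omega) hlt)
    have : D = ((I.biUnion fun S => S.verts.toFinset : Finset W) : Set W) := by
      ext w; simp [hDmem]
    rw [this, Set.ncard_coe_finset]
    refine card_biUnion_le_card_mul _ _ _ fun S hS => ?_
    rw [← Set.ncard_eq_toFinset_card']
    exact (hstar S hS).1
  rcases hcut with hcut | ⟨w, hw⟩
  · obtain ⟨p, hpD, hp⟩ := h.exists_isolated hiso D hcut hDcard
    have hpG : e p ∈ G.edgeSet := h.range_eq ▸ Set.mem_range_self p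
    obtain ⟨u, v, huv⟩ : ∃ u v, e p = s(u, v) := by
      induction he : e p with | _ u v => exact ⟨u, v, rfl⟩
    rw [huv, SimpleGraph.mem_edgeSet] at hpG
    have hcov : ∀ x y, e p = s(x, y) → ∀ d ∈ otherEdges G x y,
        ∃ S ∈ I, d ∈ S.verts.toFinset.image e := by
      intro x y hxy d hd
      obtain ⟨z, hxz, hzy, rfl⟩ := mem_otherEdges.1 hd
      obtain ⟨q, hq⟩ : s(x, z) ∈ Set.range e := h.range_eq ▸ hxz
      have : q ∈ D := by
        refine hp q ((h.adj_iff p q).2 ⟨?_, x, by simp [hxy], by simp [hq]⟩)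
        rintro rfl
        rw [hxy] at hq
        simp only [Sym2.eq_iff] at hq
        rcases hq with ⟨-, h⟩ | ⟨rfl, h⟩
        · exact hzy h.symm
        · exact hzy h.symm
      obtain ⟨S, hS, hqS⟩ := (hDmem q).1 this
      exact ⟨S, hS, mem_image.2 ⟨q, by simpa using hqS, hq⟩⟩
    have hstars : ∀ S ∈ I, IsEdgeStar G (1 + t) (S.verts.toFinset.image e) := by
      intro S hS
      obtain ⟨h1, c, hc, h2⟩ := hstar S hS
      refine ⟨?_, e c, mem_image_of_mem e (by simpa using hc), h.range_eq ▸ Set.mem_range_self c, ?_⟩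
      · rw [card_image_of_injective _ h.injective, ← Set.ncard_eq_toFinset_card']
        exact h1
      · intro d hd
        obtain ⟨w, hw, rfl⟩ := mem_image.1 hd
        rcases h2 w (by simpa using hw) with rfl | hadj
        · exact ⟨(e w).out.1, Sym2.out_fst_mem _, Sym2.out_fst_mem _⟩
        · exact ((h.adj_iff c w).1 hadj).2
    have hnot : ∀ S ∈ I, s(u, v) ∉ S.verts.toFinset.image e := by
      intro S hS hmem
      obtain ⟨w, hw, hwp⟩ := mem_image.1 hmem
      rw [← huv] at hwp
      obtain rfl := h.injective hwp
      exact hpD ((hDmem w).2 ⟨S, hS, by simpa using hw⟩)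
    obtain ⟨a, b, c, habc, ha, hb⟩ := edgeStar_cover_counts htri hpG I _ hstars hnot
      (hcov u v huv) (hcov v u (by rw [huv, Sym2.eq_swap]))
    rw [card_otherEdges hpG, hdeg] at ha
    rw [card_otherEdges hpG.symm, hdeg] at hb
    have := twoSidedCover_le (by omega) ha hb
    omega
  -- A single survivor is impossible: fewer than `3n - 4` of at least `6n` vertices are removed.
  · have := Set.ncard_add_ncard_compl D
    rw [hw, Set.ncard_singleton, Nat.card_eq_fintype_card] at this
    omega

/-! ### Upper bound -/

/-- Greedy blocks, a short one being padded from `N`: a structure cut needs stars of exact size, but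
they may overlap. -/
theorem Finset.exists_cover_card_eq {α : Type*} [DecidableEq α] {N : Finset α} {s : ℕ} (hs : s ≤ #N)
    (q : ℕ) (M : Finset α) (hMN : M ⊆ N) (hM : #M ≤ q * s) :
    ∃ 𝒜 : Finset (Finset α), #𝒜 ≤ q ∧ (∀ A ∈ 𝒜, A ⊆ N ∧ #A = s) ∧ ∀ d ∈ M, ∃ A ∈ 𝒜, d ∈ A := by
  induction q generalizing M with
  | zero =>
    rw [Nat.zero_mul, Nat.le_zero, card_eq_zero] at hM
    exact ⟨∅, by simp, by simp, by simp [hM]⟩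
  | succ q ih =>
    obtain ⟨P, hPM, hP⟩ := exists_subset_card_eq (min_le_right s #M)
    obtain ⟨A, hPA, hAN, hA⟩ :=
      exists_subsuperset_card_eq (hPM.trans hMN) (hP ▸ min_le_left s #M) hs
    obtain ⟨𝒜, h1, h2, h3⟩ := ih (M \ P) (sdiff_subset.trans hMN) (by
      rw [card_sdiff_of_subset hPM, hP]
      rw [Nat.succ_mul] at hM
      omega)
    refine ⟨insert A 𝒜, (card_insert_le _ _).trans (by omega), ?_, fun d hd => ?_⟩
    · simp only [mem_insert, forall_eq_or_imp]
      exact ⟨⟨hAN, hA⟩, h2⟩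
    · by_cases hdP : d ∈ P
      · exact ⟨A, mem_insert_self _ _, hPA hdP⟩
      · obtain ⟨A', hA', hdA'⟩ := h3 d (mem_sdiff.2 ⟨hd, hdP⟩)
        exact ⟨A', mem_insert_of_mem hA', hdA'⟩

/-- A set of `s` edges of `G` other than `p`, all of which meet a common member of the set. -/
def IsStarAvoiding {V : Type*} (G : SimpleGraph V) (s : ℕ) (p : Sym2 V) (A : Finset (Sym2 V)) :
    Prop :=
  p ∉ A ∧ #A = s ∧ (∀ d ∈ A, d ∈ G.edgeSet) ∧ ∃ c ∈ A, ∀ d ∈ A, ∃ v, v ∈ c ∧ v ∈ d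

/-- `q` stars with `s` edges suffice to cover `M`, avoiding the edge `p`. -/
def CoveredByStars {V : Type*} (G : SimpleGraph V) (s : ℕ) (p : Sym2 V) (q : ℕ)
    (M : Finset (Sym2 V)) : Prop :=
  ∃ 𝒜 : Finset (Finset (Sym2 V)), #𝒜 ≤ q ∧ (∀ A ∈ 𝒜, IsStarAvoiding G s p A) ∧
    ∀ d ∈ M, ∃ A ∈ 𝒜, d ∈ A

theorem CoveredByStars.union {V : Type*} [DecidableEq V] {G : SimpleGraph V} {s : ℕ}
    {p : Sym2 V} {q r : ℕ} {M N : Finset (Sym2 V)}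
    (hM : CoveredByStars G s p q M) (hN : CoveredByStars G s p r N) :
    CoveredByStars G s p (q + r) (M ∪ N) := by
  obtain ⟨𝒜, a1, a2, a3⟩ := hM
  obtain ⟨ℬ, b1, b2, b3⟩ := hN
  refine ⟨𝒜 ∪ ℬ, (card_union_le _ _).trans (by omega), fun A hA => ?_, fun d hd => ?_⟩
  · exact (mem_union.1 hA).elim (a2 A) (b2 A)
  · rcases mem_union.1 hd with hd | hd
    · obtain ⟨A, hA, h⟩ := a3 d hd
      exact ⟨A, mem_union_left _ hA, h⟩
    · obtain ⟨A, hA, h⟩ := b3 d hd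
      exact ⟨A, mem_union_right _ hA, h⟩

theorem notMem_otherEdges {V : Type*} [Fintype V] {G : SimpleGraph V} {u v : V} :
    s(u, v) ∉ otherEdges G u v := by
  unfold otherEdges; simp

section Cover

variable {V : Type*} [Fintype V] [DecidableEq V] {G : SimpleGraph V}

/-- Edges through `u` pairwise meet, so any `s` of them form a star centred at any one of them. -/
theorem coveredByStars_of_subset_otherEdges {u v : V} {s q : ℕ} (hs0 : 0 < s)
    (hs : s ≤ #(otherEdges G u v)) (M : Finset (Sym2 V)) (hM : M ⊆ otherEdges G u v)
    (hMq : #M ≤ q * s) : CoveredByStars G s s(u, v) q M := by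
  obtain ⟨𝒜, h1, h2, h3⟩ := exists_cover_card_eq hs q M hM hMq
  refine ⟨𝒜, h1, fun A hA => ?_, h3⟩
  obtain ⟨hAN, hAs⟩ := h2 A hA
  have hinc : ∀ d ∈ A, d ∈ G.edgeSet ∧ u ∈ d := fun d hd => by
    obtain ⟨w, hw, -, rfl⟩ := mem_otherEdges.1 (hAN hd)
    exact ⟨hw, by simp⟩
  obtain ⟨c, hc⟩ := card_pos.1 (hAs ▸ hs0)
  exact ⟨fun h => notMem_otherEdges (hAN h), hAs, fun d hd => (hinc d hd).1, c, hc,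
    fun d hd => ⟨u, (hinc c hc).2, (hinc d hd).2⟩⟩

variable [DecidableRel G.Adj]

theorem card_closed_edge_neighborhood {x y : V} (hxy : G.Adj x y) :
    #(G.incidenceFinset x ∪ G.incidenceFinset y) + 1 = G.degree x + G.degree y := by
  rw [← G.card_incidenceFinset_eq_degree, ← G.card_incidenceFinset_eq_degree,
    ← card_union_add_card_inter]
  congr 1
  symm
  rw [card_eq_one]
  refine ⟨s(x, y), ?_⟩
  rw [← coe_inj]
  push_cast
  simpa using G.incidenceSet_inter_incidenceSet_of_adj hxy

/-- A star centred at the edge `xy` containing prescribed edges `M`. -/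
theorem coveredByStars_one {x y : V} (hxy : G.Adj x y) {p : Sym2 V} {s : ℕ}
    (hs : s + 2 ≤ G.degree x + G.degree y) (M : Finset (Sym2 V)) (hpM : p ∉ M)
    (hxyM : s(x, y) ∈ M) (hM : ∀ d ∈ M, d ∈ G.edgeSet ∧ (x ∈ d ∨ y ∈ d)) (hMs : #M ≤ s) :
    CoveredByStars G s p 1 M := by
  have hN := card_closed_edge_neighborhood hxy
  set N := G.incidenceFinset x ∪ G.incidenceFinset y with hNdef
  have hNmem : ∀ d, d ∈ N ↔ d ∈ G.edgeSet ∧ (x ∈ d ∨ y ∈ d) := fun d => by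
    simp only [N, mem_union, SimpleGraph.mem_incidenceFinset, SimpleGraph.incidenceSet]
    exact and_or_left.symm
  have hMN : M ⊆ N.erase p := fun d hd =>
    mem_erase.2 ⟨fun h => hpM (h ▸ hd), (hNmem d).2 (hM d hd)⟩
  have hNp := N.pred_card_le_card_erase (a := p)
  obtain ⟨A, hMA, hAN, hA⟩ := exists_subsuperset_card_eq hMN hMs (by omega)
  refine ⟨{A}, by simp, fun A' hA' => ?_, fun d hd => ⟨A, mem_singleton_self _, hMA hd⟩⟩
  rw [mem_singleton.1 hA']
  have hAN' : ∀ d ∈ A, d ≠ p ∧ d ∈ G.edgeSet ∧ (x ∈ d ∨ y ∈ d) := fun d hd => by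
    have := mem_erase.1 (hAN hd)
    exact ⟨this.1, (hNmem d).1 this.2⟩
  refine ⟨fun h => (hAN' p h).1 rfl, hA, fun d hd => (hAN' d hd).2.1, s(x, y), hMA hxyM,
    fun d hd => ?_⟩
  rcases (hAN' d hd).2.2 with h | h
  · exact ⟨x, by simp, h⟩
  · exact ⟨y, by simp, h⟩

/-- Centre the star at some `uw` with `w ≠ v` and fill up with edges at `w`. Of the `2n - 1` edges
meeting `uw`, all but `uv` are available, whence the bound `2n - 2` on `s`. -/
theorem coveredByStars_otherEdges {n : ℕ} (hdeg : ∀ v, G.degree v = n) (hn : 2 ≤ n) {u v : V}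
    (huv : G.Adj u v) {s : ℕ} (hs : n - 1 ≤ s) (hs' : s ≤ 2 * n - 2) :
    CoveredByStars G s s(u, v) 1 (otherEdges G u v) := by
  have hcard := card_otherEdges huv
  rw [hdeg] at hcard
  obtain ⟨d, hd⟩ := card_pos.1 (by omega : 0 < #(otherEdges G u v))
  obtain ⟨w, huw, hwv, rfl⟩ := mem_otherEdges.1 hd
  refine coveredByStars_one huw (by rw [hdeg, hdeg]; omega) _ notMem_otherEdges hd ?_
    (by omega)
  intro d hd
  obtain ⟨w', h, -, rfl⟩ := mem_otherEdges.1 hd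
  exact ⟨h, Or.inl (by simp)⟩

theorem coveredByStars_twoSidedCover {n : ℕ} (hdeg : ∀ v, G.degree v = n) (hn : 4 ≤ n) {s : ℕ}
    (hs : 3 ≤ s) (hs' : s ≤ 2 * n - 2) {u v u' v' : V} (huv : G.Adj u v) (huu' : G.Adj u u')
    (hvv' : G.Adj v v') (hu'v' : G.Adj u' v') (h1 : u' ≠ v) (h2 : v' ≠ u) :
    CoveredByStars G s s(u, v) (twoSidedCover (n - 1) s)
      (otherEdges G u v ∪ otherEdges G v u) := by
  have hd := Nat.div_add_mod (n - 1) s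
  have hr := Nat.mod_lt (n - 1) (by omega : 0 < s)
  have cu : #(otherEdges G u v) = n - 1 := by rw [card_otherEdges huv, hdeg]
  have cv : #(otherEdges G v u) = n - 1 := by rw [card_otherEdges huv.symm, hdeg]
  unfold twoSidedCover
  generalize (n - 1) / s = q at *
  generalize (n - 1) % s = r at *
  have two : ∀ k, n - 1 ≤ k * s → s ≤ n - 1 → CoveredByStars G s s(u, v) (2 * k)
      (otherEdges G u v ∪ otherEdges G v u) := by
    intro k hk hsn
    rw [two_mul]
    refine .union (coveredByStars_of_subset_otherEdges (by omega) (by omega) _ subset_rfl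
      (by omega)) ?_
    rw [Sym2.eq_swap]
    exact coveredByStars_of_subset_otherEdges (by omega) (by omega) _ subset_rfl (by omega)
  have hsn : 0 < q → s ≤ n - 1 := fun hq => by
    have := Nat.mul_le_mul_left s hq
    omega
  split_ifs with h0 hr1
  · refine two q (by rw [mul_comm]; omega) (hsn (Nat.pos_of_ne_zero ?_))
    rintro rfl
    omega
  · have hq : 0 < q := Nat.pos_of_ne_zero (by rintro rfl; omega)
    have mu : s(u, u') ∈ otherEdges G u v := mem_otherEdges.2 ⟨u', huu', h1, rfl⟩
    have mv : s(v, v') ∈ otherEdges G v u := mem_otherEdges.2 ⟨v', hvv', h2, rfl⟩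
    -- Remainder 1: `q` stars on each side take all but `uu'` and `vv'`, and one star centred at
    -- `u'v'` takes both. With its centre it has three prescribed edges, hence `3 ≤ s`.
    have cover : CoveredByStars G s s(u, v) (q + q + 1) ((otherEdges G u v).erase s(u, u') ∪
        (otherEdges G v u).erase s(v, v') ∪ {s(u', v'), s(u, u'), s(v, v')}) := by
      refine .union (.union ?_ ?_) ?_
      · exact coveredByStars_of_subset_otherEdges (by omega) (by rw [cu]; exact hsn hq) _
          (erase_subset _ _) (by rw [card_erase_of_mem mu, mul_comm]; omega)
      · rw [Sym2.eq_swap]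
        exact coveredByStars_of_subset_otherEdges (by omega) (by rw [cv]; exact hsn hq) _
          (erase_subset _ _) (by rw [card_erase_of_mem mv, mul_comm]; omega)
      · refine coveredByStars_one hu'v' (by rw [hdeg, hdeg]; omega) _ ?_ (by simp) ?_
          (card_le_three.trans hs)
        · simp [h1.symm, huu'.ne, huv.ne, h2.symm]
        · simp [hu'v', huu', hvv']
    rw [two_mul]
    obtain ⟨𝒜, a1, a2, a3⟩ := cover
    refine ⟨𝒜, a1, a2, fun d hd => a3 d ?_⟩
    simp only [mem_union, mem_erase, mem_insert, mem_singleton] at hd ⊢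
    tauto
  · rcases Nat.eq_zero_or_pos q with rfl | hq
    · refine .union (q := 1) (r := 1)
        (coveredByStars_otherEdges hdeg (by omega) huv (by omega) hs') ?_
      rw [Sym2.eq_swap]
      exact coveredByStars_otherEdges hdeg (by omega) huv.symm (by omega) hs'
    · have := two (q + 1) (by rw [Nat.succ_mul, mul_comm]; omega) (hsn hq)
      exact this

end Cover

/-- Only the spokes from the centre are kept: subgraphs need not be induced, so adjacencies between
leaves do no harm. -/
theorem IsLineModel.exists_star {V W : Type*} [Fintype W] {B : SimpleGraph W} {G : SimpleGraph V}
    {e : W → Sym2 V} (h : IsLineModel B G e) {t : ℕ} {p : Sym2 V} {A : Finset (Sym2 V)}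
    (hA : IsStarAvoiding G (1 + t) p A) :
    ∃ S : B.Subgraph, S.verts = {w | e w ∈ A} ∧ Nonempty (S.coe ≃g starK t) := by
  classical
  obtain ⟨-, hcard, hG, c, hc, hstar⟩ := hA
  obtain ⟨c, rfl⟩ : c ∈ Set.range e := h.range_eq ▸ hG c hc
  let A' : Finset W := univ.filter fun w => e w ∈ A
  have hcA : c ∈ A' := by simpa [A'] using hc
  have hA' : A'.image e = A := by
    ext d
    simp only [A', mem_image, mem_filter, mem_univ, true_and]
    constructor
    · rintro ⟨w, hw, rfl⟩; exact hw
    · intro hd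
      obtain ⟨w, rfl⟩ : d ∈ Set.range e := h.range_eq ▸ hG d hd
      exact ⟨w, hd, rfl⟩
  have hL : #(A'.erase c) = t := by
    rw [card_erase_of_mem hcA, ← card_image_of_injective A' h.injective, hA', hcard]
    omega
  let ψ : Fin t ≃ A'.erase c := ((A'.erase c).equivFinOfCardEq hL).symm
  have hψ : ∀ i, (ψ i : W) ≠ c ∧ e (ψ i) ∈ A := fun i => by
    have := mem_erase.1 (ψ i).2
    exact ⟨this.1, by simpa [A'] using this.2⟩
  have hadj : ∀ i, B.Adj c (ψ i) := fun i =>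
    (h.adj_iff _ _).2 ⟨(hψ i).1.symm, hstar _ (hψ i).2⟩
  let f : SimpleGraph.Copy (starK t) B :=
    ⟨⟨Sum.elim (fun _ => c) (fun i => ψ i), by
      rintro (i | i) (j | j) hij
      · simp at hij
      · exact hadj j
      · exact (hadj i).symm
      · simp at hij⟩, by
      rintro (i | i) (j | j) hij
      · exact congrArg _ (Subsingleton.elim _ _)
      · exact absurd hij.symm (hψ j).1
      · exact absurd hij (hψ i).1
      · exact congrArg _ (ψ.injective (Subtype.ext hij))⟩
  refine ⟨f.toSubgraph, ?_, ⟨f.isoToSubgraph.symm⟩⟩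
  ext w
  simp only [SimpleGraph.Subgraph.map_verts, SimpleGraph.Subgraph.verts_top, Set.image_univ,
    Set.mem_range, Set.mem_ofPred_eq]
  constructor
  · rintro ⟨i | i, rfl⟩
    · exact hc
    · exact (hψ i).2
  · intro hw
    by_cases hwc : w = c
    · exact ⟨Sum.inl 0, hwc.symm⟩
    · refine ⟨Sum.inr (ψ.symm ⟨w, by simp [A', hw, hwc]⟩), ?_⟩
      change (ψ _ : W) = w
      rw [Equiv.apply_symm_apply]

theorem IsLineModel.exists_structureCut {V W : Type*} [Fintype V] [DecidableEq V] [Fintype W]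
    {B : SimpleGraph W} {G : SimpleGraph V} {e : W → Sym2 V}
    (h : IsLineModel B G e) {u v : V} (huv : G.Adj u v) {t k : ℕ}
    (hcov : CoveredByStars G (1 + t) s(u, v) k (otherEdges G u v ∪ otherEdges G v u))
    (hcard : k * (1 + t) + 1 < Fintype.card W) :
    ∃ F : Set B.Subgraph, IsStructureCut B (starK t) F ∧ F.encard ≤ k := by
  classical
  obtain ⟨𝒜, h1, h2, h3⟩ := hcov
  have hex := fun A : 𝒜 => h.exists_star (h2 A A.2)
  choose S hS hiso using hex
  refine ⟨Set.range S, ⟨Or.inl ?_, ?_⟩, ?_⟩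
  · have hD : ∀ w, w ∈ subgraphVerts (Set.range S) ↔ ∃ A ∈ 𝒜, e w ∈ A := fun w => by
      simp [subgraphVerts, hS]
    obtain ⟨p, hp⟩ : s(u, v) ∈ Set.range e := h.range_eq ▸ huv
    have hpD : p ∉ subgraphVerts (Set.range S) := by
      rw [hD]
      rintro ⟨A, hA, hpA⟩
      exact (h2 A hA).1 (hp ▸ hpA)
    have hDcard : #(univ.filter fun w => w ∈ subgraphVerts (Set.range S)) ≤ k * (1 + t) := by
      rw [← card_image_of_injective _ h.injective]
      calc _ ≤ #(𝒜.biUnion id) := card_le_card fun d hd => by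
              obtain ⟨w, hw, rfl⟩ := mem_image.1 hd
              obtain ⟨A, hA, hwA⟩ := (hD w).1 (mem_filter.1 hw).2
              exact mem_biUnion.2 ⟨A, hA, hwA⟩
        _ ≤ #𝒜 * (1 + t) := card_biUnion_le_card_mul _ _ _ fun A hA => (h2 A hA).2.1.le
        _ ≤ k * (1 + t) := Nat.mul_le_mul_right _ h1
    -- A second survivor is needed: it makes the isolated vertex `p` a witness of disconnection.
    obtain ⟨b, hb⟩ : ∃ b, b ∉ insert p (univ.filter fun w => w ∈ subgraphVerts (Set.range S)) := by
      by_contra! hall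
      have := card_le_card (fun w _ => hall w : (univ : Finset W) ⊆ _)
      have h' := card_insert_le p (univ.filter fun w => w ∈ subgraphVerts (Set.range S))
      rw [card_univ] at this
      omega
    simp only [mem_insert, mem_filter, mem_univ, true_and, not_or] at hb
    intro hconn
    have : Nontrivial ((subgraphVerts (Set.range S))ᶜ : Set W) :=
      ⟨⟨p, hpD⟩, ⟨b, hb.2⟩, fun h => hb.1 (congrArg Subtype.val h).symm⟩
    obtain ⟨⟨q, hq⟩, hpq⟩ := hconn.exists_adj_of_nontrivial ⟨p, hpD⟩
    apply hq
    rw [hD]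
    obtain ⟨hne, x, hxp, hxq⟩ := (h.adj_iff p q).1 hpq
    have hqG : e q ∈ G.edgeSet := h.range_eq ▸ Set.mem_range_self q
    have hne' : e q ≠ s(u, v) := fun h' => hne (h.injective (hp.trans h'.symm))
    rw [hp] at hxp
    obtain ⟨y, hy⟩ := Sym2.mem_iff_exists.1 hxq
    rw [hy] at hqG hne' ⊢
    refine h3 _ (mem_union.2 ?_)
    rcases Sym2.mem_iff.1 hxp with rfl | rfl
    · exact Or.inl (mem_otherEdges.2 ⟨y, hqG, fun h => hne' (h ▸ rfl), rfl⟩)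
    · exact Or.inr (mem_otherEdges.2 ⟨y, hqG, fun h => hne' (h ▸ Sym2.eq_swap), rfl⟩)
  · rintro _ ⟨A, rfl⟩
    exact hiso A
  · rw [← Set.image_univ]
    refine (Set.encard_image_le _ _).trans ?_
    rw [Set.encard_univ, ENat.card_eq_coe_fintype_card, Fintype.card_coe]
    exact_mod_cast h1

/-! ### The closed formula and the comparison of the two bounds. -/

theorem IsStructureCut.isSubstructureCut {V W : Type*} {G : SimpleGraph V} {H : SimpleGraph W}
    (hH : H.Connected) {F : Set G.Subgraph} (h : IsStructureCut G H F) :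
    IsSubstructureCut G H F :=
  ⟨h.1, fun S hS => ⟨⊤, ⟨SimpleGraph.Subgraph.topIso.connected_iff.2 hH⟩,
    (h.2 S hS).map fun φ => φ.trans SimpleGraph.Subgraph.topIso.symm⟩⟩

theorem starK_connected {t : ℕ} : (starK t).Connected := by
  have hadj : ∀ i, (starK t).Adj (Sum.inl 0) (Sum.inr i) := fun i => by simp
  have h0 : ∀ w, (starK t).Reachable (Sum.inl 0) w := by
    rintro (i | i)
    · rw [Subsingleton.elim i 0]
    · exact (hadj i).reachable
  exact SimpleGraph.connected_iff_exists_forall_reachable _ |>.2 ⟨_, h0⟩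

theorem cast_twoSidedCover {n t : ℕ} (hn : 4 ≤ n) (ht : 2 ≤ t) :
    (twoSidedCover (n - 1) (1 + t) : ℚ) =
      if 2 ≤ t ∧ t ≤ n - 3 ∧ (n - 1) % (1 + t) = 1 then
        (2 * (n : ℚ) - 4) / (1 + (t : ℚ)) + 1
      else
        2 * (⌈((n : ℚ) - 1) / (1 + (t : ℚ))⌉ : ℚ) := by
  have hd := Nat.div_add_mod (n - 1) (1 + t)
  have hr := Nat.mod_lt (n - 1) (by omega : 0 < 1 + t)
  unfold twoSidedCover
  generalize (n - 1) / (1 + t) = q at *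
  generalize (n - 1) % (1 + t) = r at *
  have hs : (0 : ℚ) < 1 + t := by positivity
  have hnq : (n : ℚ) - 1 = (1 + t) * q + r := by
    have : n = (1 + t) * q + r + 1 := by omega
    rw [this]; push_cast; ring
  by_cases hr1 : r = 1
  · subst hr1
    have hq : 0 < q := Nat.pos_of_ne_zero (by rintro rfl; omega)
    -- Remainder 1 with `q > 0` gives `1 + t ≤ n - 2`, so the condition `t ≤ n - 3` is automatic in
    -- this case.
    have := Nat.mul_le_mul_left (1 + t) hq
    have hn2 : 2 * (n : ℚ) - 4 = (1 + t) * (2 * q) := by push_cast at hnq; linarith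
    rw [if_neg (by omega), if_pos rfl, if_pos ⟨ht, by omega, rfl⟩, hn2, mul_div_cancel_left₀ _ hs.ne']
    push_cast
    ring
  · rw [if_neg hr1, if_neg (show ¬ (2 ≤ t ∧ t ≤ n - 3 ∧ r = 1) from fun h => hr1 h.2.2), hnq,
      add_div, mul_div_cancel_left₀ _ hs.ne']
    have hceil : ⌈(q : ℚ) + r / (1 + t)⌉ = if r = 0 then (q : ℤ) else q + 1 := by
      have hrt : (r : ℚ) / (1 + t) ≤ 1 := by
        rw [div_le_one hs]; exact_mod_cast hr.le
      split_ifs with h0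
      · simp [h0]
      · rw [Int.ceil_eq_iff]
        have : 0 < (r : ℚ) / (1 + t) := by
          have : 0 < (r : ℚ) := by exact_mod_cast Nat.pos_of_ne_zero h0
          positivity
        push_cast
        constructor <;> linarith
    rw [hceil]
    split_ifs <;> push_cast <;> ring

theorem isLineModel_bcdc {n : ℕ} (hn : 2 ≤ n) :
    IsLineModel (bcdc n) (crossedCube n) serverEdge :=
  ⟨serverEdge_injective, range_serverEdge hn, bcdc_adj_iff hn⟩

theorem theorem4p8 (n t : ℕ) (hn : 4 ≤ n) (ht : 2 ≤ t) (ht' : t ≤ 2 * n - 3) :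
    ∃ k : ℕ,
      structureConnectivity (bcdc n) (starK t) = (k : ℕ∞) ∧
      substructureConnectivity (bcdc n) (starK t) = (k : ℕ∞) ∧
      (k : ℚ) =
        if 2 ≤ t ∧ t ≤ n - 3 ∧ (n - 1) % (1 + t) = 1 then
          (2 * (n : ℚ) - 4) / (1 + (t : ℚ)) + 1
        else
          2 * (⌈((n : ℚ) - 1) / (1 + (t : ℚ))⌉ : ℚ) := by
  classical
  have hmodel := isLineModel_bcdc (n := n) (by omega)
  have : Fintype (bcdcServers n) := Fintype.ofFinite _
  have hdeg : ∀ x, (crossedCube n).degree x = n := fun x => by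
    rw [← SimpleGraph.card_neighborFinset_eq_degree, SimpleGraph.neighborFinset_eq_filter,
      card_filter]
    convert crossedCube_degree n x
  have hcard : 6 * n ≤ Fintype.card (bcdcServers n) := by
    have h1 : Fintype.card (bcdcServers n) = #(crossedCube n).edgeFinset := by
      rw [← card_univ, ← card_image_of_injective univ hmodel.injective]
      congr 1
      rw [← coe_inj, coe_image, coe_univ, Set.image_univ, hmodel.range_eq,
        SimpleGraph.coe_edgeFinset]
    have h2 := (crossedCube n).sum_degrees_eq_twice_card_edges
    simp only [hdeg, sum_const, card_univ, Fintype.card_pi, Fintype.card_bool, prod_const,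
      Fintype.card_fin, smul_eq_mul] at h2
    -- Twice the number of edges is `n * 2 ^ n`, so there are at least `8n` edges.
    have h3 : 2 ^ 4 ≤ 2 ^ n := Nat.pow_le_pow_right (by norm_num) hn
    have h4 := Nat.mul_le_mul_right n h3
    omega
  obtain ⟨u, v, u', v', huv, huu', hvv', hu'v', h1, h2⟩ : ∃ u v u' v' : BitString n,
      (crossedCube n).Adj u v ∧ (crossedCube n).Adj u u' ∧ (crossedCube n).Adj v v' ∧
      (crossedCube n).Adj u' v' ∧ u' ≠ v ∧ v' ≠ u := by
    obtain ⟨m, rfl⟩ : ∃ m, n = m + 2 := ⟨n - 2, by omega⟩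
    exact crossedCube_exists_square m
  obtain ⟨F, hF, hFk⟩ := hmodel.exists_structureCut huv
    (coveredByStars_twoSidedCover hdeg hn (s := 1 + t) (by omega) (by omega) huv huu' hvv' hu'v'
      h1 h2)
    (by have := twoSidedCover_mul_le hn (s := 1 + t) (by omega) (by omega); omega)
  have lower : ∀ F, IsSubstructureCut (bcdc n) (starK t) F →
      (twoSidedCover (n - 1) (1 + t) : ℕ∞) ≤ F.encard :=
    hmodel.twoSidedCover_le_encard hn ht ht' hdeg hcard (crossedCube_not_triangle n)
      (le_adjPairs_compl hn)
  refine ⟨twoSidedCover (n - 1) (1 + t), le_antisymm ?_ ?_, le_antisymm ?_ ?_,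
    cast_twoSidedCover hn ht⟩
  · exact (iInf₂_le F hF).trans hFk
  · exact le_iInf₂ fun F hF => lower F (hF.isSubstructureCut starK_connected)
  · exact (iInf₂_le F (hF.isSubstructureCut starK_connected)).trans hFk
  · exact le_iInf₂ lower
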